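/- **Setting.** Let $d=4$, let $L\ge 2$ be an integer, and let $\bar m^2>0$. *Covariance decomposition.* Let $\varphi:\mathbb R\to[0,\infty)$ be an even Schwartz function with $\int_0^\infty t\varphi(t)\,dt=1$ whose Fourier transform is supported in $[-1,1]$, and let $R$ be a constant with $16+\bar m^2\le 4R$. For $0\le E\le 4$ and $t>0$ put $W_t(E)=\sum_{n\in\mathbb Z}\varphi\big((\arccos(1-\tfrac12E)-2\pi n)t\big)$. For $m^2\in[0,\bar m^2]$ let $\phi^*_t(x,y;m^2)$, $x,y\in\mathbb Z^4$, be the kernel of the operator $\frac{t^2}{R}W_t\big(\frac{-\Delta+m^2}{R}\big)$, where $\Delta$ is the lattice Laplacian on $\mathbb Z^4$: $$\phi^*_t(x,y;m^2)=\frac1{(2\pi)^4}\int_{[-\pi,\pi]^4}\frac{t^2}{R}\,W_t\Big(\frac{\sum_{i}2(1-\cos k_i)+m^2}{R}\Big)\cos\big(k\cdot(y-x)\big)\,dk .$$ This gives a finite-range decomposition of the Green function, $(-\Delta+m^2)^{-1}_{x,y}=\int_0^\infty\phi_t^*(x,y;m^2)\frac{dt}{t}=\sum_{j\ge1}C_{j;x,y}$,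 where $$C_{1;x,y}=\int_0^{\frac12L}\phi_t^*(x,y;m^2)\frac{dt}t,\qquad C_{j;x,y}=\int_{\frac12L^{j-1}}^{\frac12L^j}\phi_t^*(x,y;m^2)\frac{dt}t\quad(j\ge2).$$ *Coefficients.* Fix $j\ge0$ and write $C=C_{j+1}$, $w=w_j=\sum_{i=1}^jC_i$, $w_+=w_{j+1}$. For a function $q=q_{0,x}$ on $\mathbb Z^4$ let $q^{(n)}=\sum_xq_{0,x}^n$, $q^{(**)}=\sum_xx_1^2q_{0,x}$ and $(\nabla q)^2_x=\frac12\sum_{|e|=1}(q_{0,x+e}-q_{0,x})^2$. Given coupling constants $g,\nu$, let $\eta'=2C_{0,0}$, $\nu_+=\nu+\eta'g$ and $\delta[f(\nu,w)]=f(\nu_+,w_+)-f(\nu,w)$. Define $$\beta_j=8\delta[w^{(2)}],\quad\theta_j=2\delta[(w^3)^{(**)}],\quad\xi_j'=4\big(\delta[w^{(3)}]-3w^{(2)}C_{0,0}\big)+\tfrac14\beta_j\eta_j',\quad\pi_j'=2\delta[(w\Delta w)^{(1)}],$$ $$\sigma_j=\delta[(w\Delta w)^{(**)}],\quad\zeta_j=\delta[((\nabla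 w)^2)^{(**)}],\qquad \omega_j=\tfrac14L^2\beta_j,\quad\gamma_j=L^{2(j+1)}\gamma_j'\ \ (\gamma=\eta,\xi,\pi).$$ *Flow equations.* For points $a,b\in\mathbb Z^4$ with coalescence scale $j_{ab}$ (the statement holds for any integer in place of $j_{ab}$) the map $\varphi_{\mathrm{pt},j}$ on the coupling constants is $$\begin{aligned} g_{\rm pt}&=g-\beta g^2-4g\,\delta[\nu w^{(1)}],\\ \nu_{\rm pt}&=\nu+\eta'(g+4g\nu w^{(1)})-\xi'g^2-\tfrac14\beta g\nu-\pi'g(z+y)-\delta[\nu^2w^{(1)}],\\ y_{\rm pt}&=y+\sigma gz-\zeta gy-g\,\delta[\nu(w^2)^{(**)}],\\ z_{\rm pt}&=z-\theta g^2-\tfrac12\delta[\nu^2w^{(**)}]-2z\,\delta[\nu w^{(1)}]-(y_{\rm pt}-y),\\ \lambda_{\rm pt}&=(1-\delta[\nu w^{(1)}])\lambda\ \ (j+1<j_{ab}),\qquad\lambda_{\rm pt}=\lambda\ \ (j+1\ge j_{ab}),\\ q_{\rm pt}&=q+\lambda^a\lambda^bC_{ab}, \end{aligned}$$ where $(\lambda_{\rm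 pt},\lambda)$ is $(\lambda^a_{\rm pt},\lambda^a)$ or $(\lambda^b_{\rm pt},\lambda^b)$ and similarly for $q$. The transformed map $\bar\varphi_j(\bar g_j,\bar z_j,\bar\mu_j)=(\bar g_{j+1},\bar z_{j+1},\bar\mu_{j+1})$ is $$\bar g_{j+1}=\bar g_j-\beta_j\bar g_j^2,\quad \bar z_{j+1}=\bar z_j-\theta_j\bar g_j^2,\quad \bar\mu_{j+1}=L^2\bar\mu_j+\eta_j\bar g_j-\xi_j\bar g_j^2-\omega_j\bar g_j\bar\mu_j-\pi_j\bar g_j\bar z_j .$$ *Scales.* Let $j_m=\lfloor\log_{L^2}m^{-2}\rfloor$ if $m^2>0$ and $j_m=\infty$ if $m^2=0$. For $\Omega>1$ let $$j_\Omega=\inf\{k\in\{0,1,2,\dots\}:|\beta_j|\le\Omega^{-(j-k)}\|\beta\|_\infty\text{ for all }j\ge0\},\qquad\|\beta\|_\infty=\sup_{j\ge0}|\beta_j|,$$ with $j_\Omega=\infty$ if the set is empty. **Proposition 4.4.** 1. For every $j\ge0$, each coefficient of the above flow equations is a continuous function of $m^2\in[0,\bar m^2]$. That is, $\beta_j,\theta_j,\eta'_j,\xi'_j,\pi'_j,\sigma_j,\zeta_j,w_j^{(1)},w_j^{(**)},(w_j^2)^{(**)}$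 and $C_{j+1;a,b}$, as well as $\eta_j,\xi_j,\omega_j,\pi_j$, are continuous in $m^2\in[0,\bar m^2]$; hence so are $\varphi_{{\rm pt},j}$ and $\bar\varphi_j$ at each fixed argument. 2. Fix any $\Omega>1$. There is $\delta\in(0,\bar m^2]$ such that the following hold. * For $m^2\in[0,\delta]$ the map $\bar\varphi$ satisfies Assumptions (A1–A2), with constants uniform in $m^2\in[0,\delta]$: (A1) $\|\beta\|_\infty$ is bounded, and there is $c>0$ such that $\beta_j\ge c$ for all but at most $c^{-1}$ values of $j\le j_\Omega$; (A2) each of $|\theta_j|,|\eta_j|,|\xi_j|,|\omega_j|,|\pi_j|$ is at most $K\,\Omega^{-(j-j_\Omega)_+}$ for all $j\ge0$, for some constant $K$ independent of $j$ (where $\Omega^{-(j-j_\Omega)_+}=1$ if $j_\Omega=\infty$). * $j_\Omega=j_m+O(1)$ uniformly in $m^2\in(0,\delta]$: both are finite, and $|j_\Omega-j_m|$ is bounded by a constant independent of $m^2$. If $m^2=0$, then $j_m=j_\Omega=\infty$. -/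

import Mathlib

open scoped SchwartzMap

noncomputable section

namespace PerturbativeFlow

/-! ## The finite-range decomposition of the lattice Green function on `ℤ⁴` -/

/-- The four-dimensional integer lattice. -/
abbrev Lattice : Type := Fin 4 → ℤ

/-- Admissible cutoff functions for the finite-range decomposition: `φ` is a non-negative even
Schwartz function with `∫₀^∞ t φ(t) dt = 1`, whose Fourier transform (a cosine transform,
as `φ` is even) is supported in `[-1, 1]`. -/
structure IsProfile (φ : 𝓢(ℝ, ℝ)) : Prop where
  even : ∀ u, φ (-u) = φ u
  nonneg : ∀ u, 0 ≤ φ u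
  normalized : ∫ t in Set.Ioi (0 : ℝ), t * φ t = 1
  fourier_support : ∀ s : ℝ, 1 < |s| → ∫ u, φ u * Real.cos (s * u) = 0

/-- The Fourier symbol `∑ᵢ 2 (1 - cos kᵢ)` of the lattice operator `-Δ`; it ranges over `[0, 16]`. -/
def laplaceSymbol (k : Fin 4 → ℝ) : ℝ := ∑ i, 2 * (1 - Real.cos (k i))

/-- `W_t(E) = ∑ₙ φ((arccos (1 - E/2) - 2πn) t)` for `0 ≤ E ≤ 4`. Since `φ` is even with Fourier
transform supported in `[-1, 1]`, this is a polynomial in `E` of degree at most `t`, and since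
`∑ₙ (x - 2πn)⁻² = (2 (1 - cos x))⁻¹`, one has `E⁻¹ = ∫₀^∞ t² W_t(E) dt/t`. -/
def spectralFn (φ : 𝓢(ℝ, ℝ)) (t E : ℝ) : ℝ :=
  ∑' n : ℤ, φ ((Real.arccos (1 - E / 2) - 2 * Real.pi * n) * t)

/-- The kernel `φ*_t(0, x; m²)` on `ℤ⁴` of the operator `(t²/R) W_t((-Δ + m²)/R)`, defined by
Fourier inversion on `[-π, π]⁴`. The constant `R` normalises the spectrum of `-Δ + m²` to lie
in `[0, 4]`. It has range `t`, and `∫₀^∞ φ*_t dt/t = (-Δ + m²)⁻¹`. -/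
def scaleKernel (φ : 𝓢(ℝ, ℝ)) (R t m2 : ℝ) (x : Lattice) : ℝ :=
  ((2 * Real.pi) ^ 4)⁻¹ *
    ∫ k in Set.Icc (fun _ : Fin 4 => -Real.pi) (fun _ => Real.pi),
      t ^ 2 / R * spectralFn φ t ((laplaceSymbol k + m2) / R) *
        Real.cos (∑ i, k i * (x i : ℝ))

/-- The covariances `C_{j;0,x}`, `j ≥ 1`: the integral of `φ*_t(0, x; m²) dt/t` over
`0 < t < L/2` if `j = 1` and over `L^{j-1}/2 < t < L^j/2` if `j ≥ 2`.
(The value at `j = 0` is never used.) -/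
def cov (φ : 𝓢(ℝ, ℝ)) (R : ℝ) (L : ℕ) (m2 : ℝ) (j : ℕ) (x : Lattice) : ℝ :=
  ∫ t in (if j ≤ 1 then 0 else (L : ℝ) ^ (j - 1) / 2)..((L : ℝ) ^ j / 2),
    scaleKernel φ R t m2 x / t

/-! ## Lattice operations and coefficients, for a sequence of covariances `C` -/

/-- The unit vector `eᵢ`. -/
def unit (i : Fin 4) : Lattice := Pi.single i 1

/-- The lattice Laplacian. -/
def lap (q : Lattice → ℝ) (x : Lattice) : ℝ :=
  ∑ i, (q (x + unit i) + q (x - unit i) - 2 * q x)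

/-- `(∇q)² = ½ ∑_e (∇^e q)²`, the sum being over the eight unit vectors `e = ±eᵢ`. -/
def gradSq (q : Lattice → ℝ) (x : Lattice) : ℝ :=
  1 / 2 * ∑ i, ((q (x + unit i) - q x) ^ 2 + (q (x - unit i) - q x) ^ 2)

/-- `q^{(n)} = ∑ₓ q(x)ⁿ`. -/
def powSum (n : ℕ) (q : Lattice → ℝ) : ℝ := ∑' x, q x ^ n

/-- `q^{(**)} = ∑ₓ x₁² q(x)`. -/
def secondMoment (q : Lattice → ℝ) : ℝ := ∑' x, (x 0 : ℝ) ^ 2 * q x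

/-- `w_j = C_1 + ⋯ + C_j`. -/
def w (C : ℕ → Lattice → ℝ) (j : ℕ) : Lattice → ℝ := fun x => ∑ i ∈ Finset.Icc 1 j, C i x

/-- `δ[f(w)] = f(w_{j+1}) - f(w_j)`. -/
def delta (C : ℕ → Lattice → ℝ) (j : ℕ) (f : (Lattice → ℝ) → ℝ) : ℝ :=
  f (w C (j + 1)) - f (w C j)

/-- `w_j^{(1)}`. -/
def w1 (C : ℕ → Lattice → ℝ) (j : ℕ) : ℝ := powSum 1 (w C j)

/-- `w_j^{(**)}`. -/
def wStar (C : ℕ → Lattice → ℝ) (j : ℕ) : ℝ := secondMoment (w C j)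

/-- `(w_j²)^{(**)}`. -/
def wSqStar (C : ℕ → Lattice → ℝ) (j : ℕ) : ℝ := secondMoment (fun x => w C j x ^ 2)

/-- `η' = 2 C_{j+1;0,0}`. -/
def etaPrime (C : ℕ → Lattice → ℝ) (j : ℕ) : ℝ := 2 * C (j + 1) 0

/-- `β = 8 δ[w^{(2)}]`. -/
def beta (C : ℕ → Lattice → ℝ) (j : ℕ) : ℝ := 8 * delta C j (powSum 2)

/-- `θ = 2 δ[(w³)^{(**)}]`. -/
def theta (C : ℕ → Lattice → ℝ) (j : ℕ) : ℝ :=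
  2 * delta C j (fun q => secondMoment (fun x => q x ^ 3))

/-- `ξ' = 4 (δ[w^{(3)}] - 3 w^{(2)} C_{0,0}) + ¼ β η'`. -/
def xiPrime (C : ℕ → Lattice → ℝ) (j : ℕ) : ℝ :=
  4 * (delta C j (powSum 3) - 3 * powSum 2 (w C j) * C (j + 1) 0)
    + 1 / 4 * beta C j * etaPrime C j

/-- `π' = 2 δ[(w Δw)^{(1)}]`. -/
def piPrime (C : ℕ → Lattice → ℝ) (j : ℕ) : ℝ :=
  2 * delta C j (fun q => powSum 1 (fun x => q x * lap q x))

/-- `σ = δ[(w Δw)^{(**)}]`. -/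
def sigma (C : ℕ → Lattice → ℝ) (j : ℕ) : ℝ :=
  delta C j (fun q => secondMoment (fun x => q x * lap q x))

/-- `ζ = δ[((∇w)²)^{(**)}]`. -/
def zeta (C : ℕ → Lattice → ℝ) (j : ℕ) : ℝ :=
  delta C j (fun q => secondMoment (gradSq q))

/-! ## The flow map `φ_pt` of the coupling constants -/

/-- The names of the eight coupling constants. -/
inductive Coupling : Type
  | g | nu | y | z | lamA | lamB | qA | qB

/-- The map `φ_{pt,j}`, for observables at the points `a, b` with coalescence scale `jab`. -/
def phiPt (C : ℕ → Lattice → ℝ) (a b : Lattice) (jab : ℤ) (j : ℕ) (V : Coupling → ℂ) :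
    Coupling → ℂ :=
  let g := V .g
  let nu := V .nu
  let y := V .y
  let z := V .z
  let nuPlus := nu + etaPrime C j * g
  -- `δ[ν w^{(1)}]`, `δ[ν² w^{(1)}]`, `δ[ν² w^{(**)}]`, `δ[ν (w²)^{(**)}]`
  let dNuW1 := nuPlus * w1 C (j + 1) - nu * w1 C j
  let dNuSqW1 := nuPlus ^ 2 * w1 C (j + 1) - nu ^ 2 * w1 C j
  let dNuSqWStar := nuPlus ^ 2 * wStar C (j + 1) - nu ^ 2 * wStar C j
  let dNuWSqStar := nuPlus * wSqStar C (j + 1) - nu * wSqStar C j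
  let yPt := y + sigma C j * g * z - zeta C j * g * y - g * dNuWSqStar
  let lamPt (lam : ℂ) : ℂ := if (j : ℤ) + 1 < jab then (1 - dNuW1) * lam else lam
  let qPt (q : ℂ) : ℂ := q + V .lamA * V .lamB * C (j + 1) (b - a)
  fun
  | .g => g - beta C j * g ^ 2 - 4 * g * dNuW1
  | .nu => nu + etaPrime C j * (g + 4 * g * nu * w1 C j) - xiPrime C j * g ^ 2
      - 1 / 4 * beta C j * g * nu - piPrime C j * g * (z + y) - dNuSqW1
  | .y => yPt
  | .z => z - theta C j * g ^ 2 - 1 / 2 * dNuSqWStar - 2 * z * dNuW1 - (yPt - y)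
  | .lamA => lamPt (V .lamA)
  | .lamB => lamPt (V .lamB)
  | .qA => qPt (V .qA)
  | .qB => qPt (V .qB)

/-! ## The transformed flow `φ̄` -/

/-- The coefficients of a transformed flow
`ḡ₊ = ḡ - β_j ḡ²`, `z̄₊ = z̄ - θ_j ḡ²`,
`μ̄₊ = L² μ̄ + η_j ḡ - ξ_j ḡ² - ω_j ḡ μ̄ - π_j ḡ z̄`. -/
structure BarFlow where
  /-- the scale factor -/
  L : ℕ
  /-- the coefficients `β_j` -/
  beta : ℕ → ℝ
  /-- the coefficients `θ_j` -/
  theta : ℕ → ℝ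
  /-- the coefficients `η_j` -/
  eta : ℕ → ℝ
  /-- the coefficients `ξ_j` -/
  xi : ℕ → ℝ
  /-- the coefficients `ω_j` -/
  omega : ℕ → ℝ
  /-- the coefficients `π_j` -/
  pi : ℕ → ℝ

/-- The map `(ḡ_j, z̄_j, μ̄_j) ↦ (ḡ_{j+1}, z̄_{j+1}, μ̄_{j+1})`. -/
def BarFlow.map (F : BarFlow) (j : ℕ) (V : ℝ × ℝ × ℝ) : ℝ × ℝ × ℝ :=
  let g := V.1
  let z := V.2.1
  let mu := V.2.2
  (g - F.beta j * g ^ 2,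
    z - F.theta j * g ^ 2,
    (F.L : ℝ) ^ 2 * mu + F.eta j * g - F.xi j * g ^ 2 - F.omega j * g * mu - F.pi j * g * z)

/-- The flow `φ̄` of a sequence of covariances: `ω_j = ¼ L² β_j` and `γ_j = L^{2(j+1)} γ'_j` for
`γ = η, ξ, π`. -/
def barFlow (L : ℕ) (C : ℕ → Lattice → ℝ) : BarFlow where
  L := L
  beta := beta C
  theta := theta C
  eta j := (L : ℝ) ^ (2 * (j + 1)) * etaPrime C j
  xi j := (L : ℝ) ^ (2 * (j + 1)) * xiPrime C j
  omega j := (L : ℝ) ^ 2 * (1 / 4) * beta C j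
  pi j := (L : ℝ) ^ (2 * (j + 1)) * piPrime C j

/-! ## The scales `j_m`, `j_Ω` and the Assumptions (A1), (A2) -/

/-- The mass scale: `j_m = ⌊log_{L²} m⁻²⌋` if `m² > 0`, and `∞` if `m² = 0`. -/
def massScale (L : ℕ) (m2 : ℝ) : WithTop ℤ :=
  if 0 < m2 then ((⌊Real.logb ((L : ℝ) ^ 2) m2⁻¹⌋ : ℤ) : WithTop ℤ) else ⊤

/-- `‖β‖_∞ = sup_j |β_j|`, for a bounded sequence `β`. -/
def supNorm (β : ℕ → ℝ) : ℝ := ⨆ j, |β j|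

/-- `j_Ω = inf {k ≥ 0 : |β_j| ≤ Ω^{-(j-k)} ‖β‖_∞ for all j}`, with value `∞` if there is no such
`k`. -/
def jOmega (Ω : ℝ) (β : ℕ → ℝ) : ℕ∞ :=
  sInf {n : ℕ∞ | ∃ k : ℕ, n = k ∧ ∀ j : ℕ, |β j| ≤ Ω ^ (-((j : ℤ) - (k : ℤ))) * supNorm β}

/-- `Ω^{-(j - J)_+}`, which is `1` if `J = ∞` (subtraction in `ℕ∞` is truncated at `0`). -/
def decay (Ω : ℝ) (J : ℕ∞) (j : ℕ) : ℝ := (Ω ^ ((j : ℕ∞) - J).toNat)⁻¹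

/-- Assumption (A1) with explicit constants: `‖β‖_∞ ≤ M`, and `β_j ≥ c` for all but at most
`c⁻¹` values of `j ≤ j_Ω`. -/
def AssumptionA1 (Ω M c : ℝ) (F : BarFlow) : Prop :=
  (∀ j, |F.beta j| ≤ M) ∧
    {j : ℕ | (j : ℕ∞) ≤ jOmega Ω F.beta ∧ F.beta j < c}.Finite ∧
    ({j : ℕ | (j : ℕ∞) ≤ jOmega Ω F.beta ∧ F.beta j < c}.ncard : ℝ) ≤ c⁻¹

/-- Assumption (A2) with an explicit constant: `θ_j, η_j, ξ_j, ω_j, π_j` are bounded in absolute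
value by `K Ω^{-(j - j_Ω)_+}`. -/
def AssumptionA2 (Ω K : ℝ) (F : BarFlow) : Prop :=
  ∀ j,
    |F.theta j| ≤ K * decay Ω (jOmega Ω F.beta) j ∧
    |F.eta j| ≤ K * decay Ω (jOmega Ω F.beta) j ∧
    |F.xi j| ≤ K * decay Ω (jOmega Ω F.beta) j ∧
    |F.omega j| ≤ K * decay Ω (jOmega Ω F.beta) j ∧
    |F.pi j| ≤ K * decay Ω (jOmega Ω F.beta) j

end PerturbativeFlow

end

/-!
The two parts of the theorem rest on two properties of the finite-range decomposition.

*Separation of variables.* Since the cosine transform of `φ` vanishes outside `[-1, 1]`, Poisson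
summation writes `W_t(E)`, for `t ≤ N`, as a combination of the Chebyshev polynomials
`T_p(1 - E/2)`, `|p| ≤ N`, whose coefficients depend on `t` only (`IsProfile.spectralFn_eq_sum`).
As `T_p(1 - E/2)` is an even trigonometric polynomial of the momentum, the covariances are finite
sums of a constant times a Fourier coefficient that is continuous in `m²`
(`IsProfile.cov_eq_sum`), and they vanish outside a box (`IsProfile.cov_eq_zero`). All sums over the
lattice are therefore finite, and continuity of the coefficients follows.

*Size of the covariances.* The rapid decay of `φ` gives `W_t(E) ≤ K (1 + E t²)^{-N}`. Integrating
over the torus, where `-Δ` has symbol comparable to `|k|²`, one finds that `C_{j+1}` is of order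
`L^{-2j}`, its Laplacian of order `L^{-4j}` and `C_{j+1;0,x} - C_{j+1;0,0}` of order `|x|² L^{-4j}`,
all with a factor `(1 + m² L^{2j} / (4R))^{-s}` with `s` as large as one likes (`exists_covBounds`).
Summing the scales, `∑ₓ |w_j(x)|` is of order `L^{2j}` and `|w_j(x)|` is of order `|x|⁻²`; this
bounds every coefficient by the decay factor (`exists_barFlow_le`). For `ξ` the increment
`C_x - C_0` compensates the logarithmic growth of `w^{(2)}`, and for `π` one sums by parts.

For the lower bound on `β`, positivity of `φ` makes the Fourier transform of each covariance
non-negative, so that `∑ₓ w_j(x) C_{j+1}(x) ≥ 0` by Parseval and `β_j ≥ 8 ∑ₓ C_{j+1}(x)²`. By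
Cauchy-Schwarz the latter sum is at least `|Ĉ_{j+1}(k)|²` divided by the number of points in the
range, for any one momentum `k`; at a suitable `k` of order `L^{-j}` this is bounded below uniformly
in `j`, as long as `m² L^{2j}` is small (`exists_le_beta`). No asymptotics of `β_j` are needed.

Hence `β_j` is of order one up to the mass scale `j_m` and decays geometrically, faster than
`Ω^{-(j - j_m)}`, beyond it, which pins `j_Ω` to `j_m` up to a constant and yields (A1) and (A2)
(`scale_estimates`, `le_mul_decay`). At `m² = 0` the lower bound holds at all large scales, and
`j_Ω = ∞` (`jOmega_eq_top`).
-/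

noncomputable section

namespace PerturbativeFlow

/-! ### Trigonometric polynomials on the torus -/

/-- The pairing `k · x` of a momentum with a lattice point. -/
def dot (k : Fin 4 → ℝ) (x : Lattice) : ℝ := ∑ i, k i * (x i : ℝ)

/-- The Brillouin zone `[-π, π]⁴`. -/
def torus : Set (Fin 4 → ℝ) := Set.Icc (fun _ : Fin 4 => -Real.pi) (fun _ => Real.pi)

/-- The cosine Fourier coefficient at the lattice point `x` of a function on the torus. -/
def latticeCoeff (F : (Fin 4 → ℝ) → ℝ) (x : Lattice) : ℝ :=
  ((2 * Real.pi) ^ 4)⁻¹ * ∫ k in torus, F k * Real.cos (dot k x)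

/-- The cube of lattice points whose coordinates are at most `n` in absolute value. -/
def box (n : ℕ) : Finset Lattice := Finset.Icc (fun _ => -(n : ℤ)) (fun _ => (n : ℤ))

/-- The even trigonometric polynomials with frequencies in `box n`. -/
def trigPoly (n : ℕ) : Submodule ℝ ((Fin 4 → ℝ) → ℝ) :=
  Submodule.span ℝ ((fun (y : Lattice) (k : Fin 4 → ℝ) => Real.cos (dot k y)) '' (box n : Set Lattice))

lemma mem_box {n : ℕ} {x : Lattice} : x ∈ box n ↔ ∀ i, |x i| ≤ n := by
  simp only [box, Finset.mem_Icc, Pi.le_def, abs_le]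
  exact ⟨fun h i => ⟨h.1 i, h.2 i⟩, fun h => ⟨fun i => (h i).1, fun i => (h i).2⟩⟩

lemma box_mono {m n : ℕ} (h : m ≤ n) : box m ⊆ box n := fun x hx =>
  mem_box.2 fun i => (mem_box.1 hx i).trans (by exact_mod_cast h)

lemma neg_mem_box {n : ℕ} {x : Lattice} : -x ∈ box n ↔ x ∈ box n := by
  simp [mem_box]

lemma card_box (n : ℕ) : (box n).card = (2 * n + 1) ^ 4 := by
  simp only [box, Pi.card_Icc, Int.card_Icc, Finset.prod_const, Finset.card_univ, Fintype.card_fin]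
  congr 1
  lia

lemma add_unit_mem_box {n : ℕ} {x : Lattice} (hx : x ∈ box n) (i : Fin 4) :
    x + unit i ∈ box (n + 1) ∧ x - unit i ∈ box (n + 1) := by
  have hu : ∀ l, |unit i l| ≤ 1 := by
    intro l
    by_cases h : l = i <;> simp [unit, h]
  simp only [mem_box] at hx ⊢
  refine ⟨fun l => ?_, fun l => ?_⟩
  · have := abs_add_le (x l) (unit i l)
    have := hu l; have := hx l
    simp only [Pi.add_apply]; push_cast; linarith
  · have := abs_sub (x l) (unit i l)
    have := hu l; have := hx l
    simp only [Pi.sub_apply]; push_cast; linarith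

@[fun_prop]
lemma continuous_dot (x : Lattice) : Continuous fun k : Fin 4 → ℝ => dot k x := by
  unfold dot; fun_prop

lemma dot_add (k : Fin 4 → ℝ) (x y : Lattice) : dot k (x + y) = dot k x + dot k y := by
  simp [dot, mul_add, Finset.sum_add_distrib]

lemma dot_neg (k : Fin 4 → ℝ) (x : Lattice) : dot k (-x) = -dot k x := by
  simp [dot]

lemma dot_sub (k : Fin 4 → ℝ) (x y : Lattice) : dot k (x - y) = dot k x - dot k y := by
  rw [sub_eq_add_neg, dot_add, dot_neg, sub_eq_add_neg]

@[simp] lemma dot_zero (k : Fin 4 → ℝ) : dot k 0 = 0 := by simp [dot]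

lemma dot_unit (k : Fin 4 → ℝ) (i : Fin 4) : dot k (unit i) = k i := by
  simp [dot, unit, Pi.single_apply]

lemma isCompact_torus : IsCompact torus := isCompact_Icc

lemma measurableSet_torus : MeasurableSet torus := measurableSet_Icc

lemma Continuous.integrableOn_torus {F : (Fin 4 → ℝ) → ℝ} (hF : Continuous F) :
    MeasureTheory.IntegrableOn F torus :=
  hF.continuousOn.integrableOn_compact isCompact_torus

lemma volume_restrict_torus : (MeasureTheory.volume.restrict torus : MeasureTheory.Measure (Fin 4 → ℝ))
    = MeasureTheory.Measure.pi fun _ => MeasureTheory.volume.restrict (Set.Icc (-Real.pi) Real.pi) := by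
  rw [torus, ← Set.pi_univ_Icc, MeasureTheory.volume_pi, MeasureTheory.Measure.restrict_pi_pi]

lemma integral_torus_prod {𝕜 : Type*} [RCLike 𝕜] (f : Fin 4 → ℝ → 𝕜) :
    ∫ k in torus, ∏ i, f i (k i) = ∏ i, ∫ u in Set.Icc (-Real.pi) Real.pi, f i u := by
  rw [volume_restrict_torus, MeasureTheory.integral_fintype_prod_eq_prod]

lemma integral_exp_int (n : ℤ) :
    ∫ u in Set.Icc (-Real.pi) Real.pi, Complex.exp (u * n * Complex.I)
      = if n = 0 then (2 * Real.pi : ℂ) else 0 := by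
  rw [MeasureTheory.integral_Icc_eq_integral_Ioc,
    ← intervalIntegral.integral_of_le (by linarith [Real.pi_pos])]
  split_ifs with h
  · subst h
    simp
    ring
  · have hc : (n : ℂ) * Complex.I ≠ 0 := by simp [h]
    have := integral_exp_mul_complex (a := -Real.pi) (b := Real.pi) hc
    have e : ∀ u : ℝ, Complex.exp (u * n * Complex.I) = Complex.exp (n * Complex.I * u) := by
      intro u; congr 1; ring
    simp_rw [e]
    rw [this]
    have h2 : Complex.exp (n * Complex.I * (Real.pi : ℝ)) = Complex.exp (n * Complex.I * ((-Real.pi : ℝ) : ℂ)) := by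
      rw [Complex.exp_eq_exp_iff_exists_int]
      exact ⟨n, by push_cast; ring⟩
    rw [h2, sub_self, zero_div]

lemma integral_cos_dot (x : Lattice) :
    ∫ k in torus, Real.cos (dot k x) = if x = 0 then (2 * Real.pi) ^ 4 else 0 := by
  have h1 : ∫ k in torus, Complex.exp (dot k x * Complex.I)
      = if x = 0 then (2 * Real.pi : ℂ) ^ 4 else 0 := by
    have e : ∀ k : Fin 4 → ℝ, Complex.exp (dot k x * Complex.I)
        = ∏ i, Complex.exp ((k i : ℂ) * (x i : ℤ) * Complex.I) := by
      intro k
      rw [← Complex.exp_sum]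
      congr 1
      simp [dot, Finset.sum_mul]
    simp_rw [e]
    rw [integral_torus_prod (fun i u => Complex.exp ((u : ℂ) * (x i : ℤ) * Complex.I))]
    simp_rw [integral_exp_int]
    split_ifs with h
    · subst h; simp
    · obtain ⟨i, hi⟩ := Function.ne_iff.1 h
      exact Finset.prod_eq_zero (Finset.mem_univ i) (by simp at hi; simp [hi])
  have hint : MeasureTheory.IntegrableOn (fun k => Complex.exp (dot k x * Complex.I)) torus := by
    have hc : Continuous fun k : Fin 4 → ℝ => Complex.exp (dot k x * Complex.I) := by fun_prop
    exact hc.continuousOn.integrableOn_compact isCompact_torus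
  have h2 := congrArg Complex.re h1
  rw [← RCLike.re_eq_complex_re, ← integral_re hint] at h2
  simp only [RCLike.re_eq_complex_re, Complex.exp_ofReal_mul_I_re] at h2
  rw [h2]
  split_ifs
  · rw [← Complex.ofReal_re ((2 * Real.pi) ^ 4)]
    push_cast
    rfl
  · simp

lemma latticeCoeff_cos (x y : Lattice) :
    latticeCoeff (fun k => Real.cos (dot k y)) x
      = ((if x = y then 1 else 0) + (if x = -y then 1 else 0)) / 2 := by
  have e : ∀ k, Real.cos (dot k y) * Real.cos (dot k x)
      = (1 / 2) * (Real.cos (dot k (x - y)) + Real.cos (dot k (x + y))) := by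
    intro k
    rw [dot_add, dot_sub, Real.cos_add, Real.cos_sub]; ring
  have hpi : ((2 * Real.pi) ^ 4) ≠ 0 := by positivity
  unfold latticeCoeff
  simp_rw [e]
  rw [MeasureTheory.integral_const_mul, MeasureTheory.integral_add
    (Continuous.integrableOn_torus (by fun_prop)) (Continuous.integrableOn_torus (by fun_prop)),
    integral_cos_dot, integral_cos_dot]
  simp only [sub_eq_zero, add_eq_zero_iff_eq_neg]
  split_ifs <;> field_simp <;> norm_num

lemma latticeCoeff_add {F G : (Fin 4 → ℝ) → ℝ} (hF : Continuous F) (hG : Continuous G)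
    (x : Lattice) :
    latticeCoeff (F + G) x = latticeCoeff F x + latticeCoeff G x := by
  unfold latticeCoeff
  simp only [Pi.add_apply, add_mul]
  rw [MeasureTheory.integral_add
    (Continuous.integrableOn_torus (by fun_prop)) (Continuous.integrableOn_torus (by fun_prop)),
    mul_add]

lemma latticeCoeff_smul (c : ℝ) (F : (Fin 4 → ℝ) → ℝ) (x : Lattice) :
    latticeCoeff (c • F) x = c * latticeCoeff F x := by
  unfold latticeCoeff
  simp only [Pi.smul_apply, smul_eq_mul, mul_assoc]
  rw [MeasureTheory.integral_const_mul]
  ring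

lemma latticeCoeff_zero (x : Lattice) : latticeCoeff 0 x = 0 := by
  simp [latticeCoeff]

lemma trigPoly_mono {m n : ℕ} (h : m ≤ n) : trigPoly m ≤ trigPoly n :=
  Submodule.span_mono (Set.image_mono (by exact_mod_cast box_mono h))

lemma cos_dot_mem_trigPoly {n : ℕ} {y : Lattice} (hy : y ∈ box n) :
    (fun k : Fin 4 → ℝ => Real.cos (dot k y)) ∈ trigPoly n :=
  Submodule.subset_span ⟨y, hy, rfl⟩

lemma continuous_of_mem_trigPoly {n : ℕ} {F : (Fin 4 → ℝ) → ℝ} (hF : F ∈ trigPoly n) :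
    Continuous F := by
  induction hF using Submodule.span_induction with
  | mem F h => obtain ⟨y, -, rfl⟩ := h; simp only; fun_prop
  | zero => exact continuous_zero
  | add F G _ _ hF hG => exact hF.add hG
  | smul c F _ hF => exact hF.const_smul c

/-- Finite range: a trigonometric polynomial has no Fourier coefficient outside its box. -/
lemma latticeCoeff_eq_zero {n : ℕ} {F : (Fin 4 → ℝ) → ℝ} (hF : F ∈ trigPoly n) {x : Lattice}
    (hx : x ∉ box n) : latticeCoeff F x = 0 := by
  induction hF using Submodule.span_induction with
  | mem F h =>
    obtain ⟨y, hy, rfl⟩ := h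
    simp only [latticeCoeff_cos]
    rw [if_neg (by rintro rfl; exact hx hy), if_neg (by rintro rfl; exact hx (neg_mem_box.2 hy))]
    norm_num
  | zero => exact latticeCoeff_zero x
  | add F G hF' hG' hF hG =>
    rw [latticeCoeff_add (continuous_of_mem_trigPoly hF') (continuous_of_mem_trigPoly hG'), hF, hG,
      add_zero]
  | smul c F _ hF => rw [latticeCoeff_smul, hF, mul_zero]

/-- Fourier inversion for trigonometric polynomials. -/
lemma sum_latticeCoeff_mul_cos {n : ℕ} {F : (Fin 4 → ℝ) → ℝ} (hF : F ∈ trigPoly n)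
    (k : Fin 4 → ℝ) : ∑ x ∈ box n, latticeCoeff F x * Real.cos (dot k x) = F k := by
  induction hF using Submodule.span_induction with
  | mem F h =>
    obtain ⟨y, hy, rfl⟩ := h
    have hy' : y ∈ box n := hy
    simp only [latticeCoeff_cos, add_div, add_mul, Finset.sum_add_distrib, ite_div, ite_mul, zero_div,
      zero_mul, Finset.sum_ite_eq', neg_mem_box, hy', if_true, dot_neg, Real.cos_neg]
    ring
  | zero => simp [latticeCoeff_zero]
  | add F G hF' hG' hF hG =>
    simp only [latticeCoeff_add (continuous_of_mem_trigPoly hF') (continuous_of_mem_trigPoly hG'),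
      add_mul, Finset.sum_add_distrib, hF, hG, Pi.add_apply]
  | smul c F _ hF =>
    simp only [latticeCoeff_smul, mul_assoc, ← Finset.mul_sum, hF, Pi.smul_apply, smul_eq_mul]

lemma cos_mul_mem_trigPoly {n : ℕ} {F : (Fin 4 → ℝ) → ℝ} (hF : F ∈ trigPoly n) (i : Fin 4) :
    (fun k => Real.cos (k i) * F k) ∈ trigPoly (n + 1) := by
  induction hF using Submodule.span_induction with
  | mem F h =>
    obtain ⟨y, hy, rfl⟩ := h
    have hu := add_unit_mem_box (Finset.mem_coe.1 hy) i
    have := (trigPoly (n + 1)).smul_mem (1 / 2)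
      ((trigPoly (n + 1)).add_mem (cos_dot_mem_trigPoly hu.1) (cos_dot_mem_trigPoly hu.2))
    convert this using 1
    funext k
    simp only [Pi.smul_apply, Pi.add_apply, smul_eq_mul, dot_add, dot_sub, dot_unit, Real.cos_add,
      Real.cos_sub]
    ring
  | zero =>
    convert (trigPoly (n + 1)).zero_mem using 1
    funext k
    simp
  | add F G _ _ hF hG =>
    convert (trigPoly (n + 1)).add_mem hF hG using 1
    funext k
    simp [mul_add]
  | smul c F _ hF =>
    convert (trigPoly (n + 1)).smul_mem c hF using 1
    funext k
    simp only [Pi.smul_apply, smul_eq_mul]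
    ring

lemma laplaceSymbol_mul_mem_trigPoly {n : ℕ} {F : (Fin 4 → ℝ) → ℝ} (hF : F ∈ trigPoly n) :
    (fun k => laplaceSymbol k * F k) ∈ trigPoly (n + 1) := by
  have h : ∀ i : Fin 4, (2 : ℝ) • (F - fun k => Real.cos (k i) * F k) ∈ trigPoly (n + 1) := fun i =>
    (trigPoly (n + 1)).smul_mem _ ((trigPoly (n + 1)).sub_mem (trigPoly_mono n.le_succ hF)
      (cos_mul_mem_trigPoly hF i))
  convert (trigPoly (n + 1)).sum_mem (t := Finset.univ) fun i _ => h i using 1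
  funext k
  simp only [laplaceSymbol, Finset.sum_mul, Finset.sum_apply, Pi.smul_apply, Pi.sub_apply, smul_eq_mul]
  exact Finset.sum_congr rfl fun i _ => by ring

lemma pow_mem_trigPoly (a b : ℝ) (n : ℕ) :
    (fun k => (a + b * laplaceSymbol k) ^ n) ∈ trigPoly n := by
  induction n with
  | zero =>
    have : (0 : Lattice) ∈ box 0 := by simp [mem_box]
    convert cos_dot_mem_trigPoly this using 1
    funext k
    simp
  | succ n ih =>
    convert (trigPoly (n + 1)).add_mem ((trigPoly (n + 1)).smul_mem a (trigPoly_mono n.le_succ ih))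
      ((trigPoly (n + 1)).smul_mem b (laplaceSymbol_mul_mem_trigPoly ih)) using 1
    funext k
    simp only [Pi.smul_apply, Pi.add_apply, smul_eq_mul]
    ring

lemma eval_mem_trigPoly (a b : ℝ) {P : Polynomial ℝ} {n : ℕ} (hP : P.natDegree ≤ n) :
    (fun k => P.eval (a + b * laplaceSymbol k)) ∈ trigPoly n := by
  have : ∀ i ∈ Finset.range (n + 1), P.coeff i • (fun k => (a + b * laplaceSymbol k) ^ i) ∈ trigPoly n :=
    fun i hi => (trigPoly n).smul_mem _
      (trigPoly_mono (Nat.lt_succ_iff.1 (Finset.mem_range.1 hi)) (pow_mem_trigPoly a b i))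
  convert (trigPoly n).sum_mem this using 1
  funext k
  rw [Polynomial.eval_eq_sum_range' (Nat.lt_succ_of_le hP)]
  simp

@[fun_prop]
lemma continuous_laplaceSymbol : Continuous laplaceSymbol := by
  unfold laplaceSymbol; fun_prop

lemma laplaceSymbol_nonneg (k : Fin 4 → ℝ) : 0 ≤ laplaceSymbol k :=
  Finset.sum_nonneg fun i _ => by linarith [Real.cos_le_one (k i)]

lemma laplaceSymbol_le (k : Fin 4 → ℝ) : laplaceSymbol k ≤ 16 := by
  have : laplaceSymbol k ≤ ∑ _i : Fin 4, (4 : ℝ) :=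
    Finset.sum_le_sum fun i _ => by linarith [Real.neg_one_le_cos (k i)]
  simpa using this.trans (by norm_num)

lemma mul_sq_le_laplaceSymbol {k : Fin 4 → ℝ} (hk : k ∈ torus) :
    4 / Real.pi ^ 2 * ∑ i, k i ^ 2 ≤ laplaceSymbol k := by
  rw [Finset.mul_sum]
  refine Finset.sum_le_sum fun i _ => ?_
  have := Real.cos_le_one_sub_mul_cos_sq (abs_le.2 ⟨hk.1 i, hk.2 i⟩)
  have e : 4 / Real.pi ^ 2 * k i ^ 2 = 2 * (2 / Real.pi ^ 2 * k i ^ 2) := by ring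
  linarith

/-- `1 - cos (k · x)` is controlled by the symbol of `-Δ`. -/
lemma one_sub_cos_dot_le {k : Fin 4 → ℝ} (hk : k ∈ torus) (x : Lattice) :
    1 - Real.cos (dot k x) ≤ Real.pi ^ 2 / 8 * laplaceSymbol k * ∑ i, (x i : ℝ) ^ 2 := by
  have h1 := Real.one_sub_sq_div_two_le_cos (x := dot k x)
  have h2 : dot k x ^ 2 ≤ (∑ i, k i ^ 2) * ∑ i, (x i : ℝ) ^ 2 :=
    Finset.sum_mul_sq_le_sq_mul_sq _ _ _
  have h3 := mul_sq_le_laplaceSymbol hk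
  have hpi := Real.pi_pos
  have h4 : ∑ i, k i ^ 2 ≤ Real.pi ^ 2 / 4 * laplaceSymbol k := by
    rw [div_mul_eq_mul_div, div_le_iff₀ (by positivity)] at h3
    linarith
  have h5 := mul_le_mul_of_nonneg_right h4
    (Finset.sum_nonneg fun i (_ : i ∈ Finset.univ) => sq_nonneg (x i : ℝ))
  nlinarith

/-! ### The spectral function -/

/-- Rapid decay of a Schwartz function, in a form adapted to `1 + u²`. -/
lemma exists_decay (φ : 𝓢(ℝ, ℝ)) (N : ℕ) :
    ∃ K, 0 ≤ K ∧ ∀ u, |φ u| ≤ K * ((1 + u ^ 2) ^ N)⁻¹ := by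
  refine ⟨2 ^ (2 * N) * (Finset.Iic (2 * N, 0)).sup (fun m => SchwartzMap.seminorm ℝ m.1 m.2) φ,
    by positivity, fun u => ?_⟩
  have h := SchwartzMap.one_add_le_sup_seminorm_apply (𝕜 := ℝ) (m := (2 * N, 0)) (k := 2 * N)
    (n := 0) le_rfl le_rfl φ u
  simp only [norm_iteratedFDeriv_zero, Real.norm_eq_abs] at h
  rw [← div_eq_mul_inv, le_div_iff₀ (by positivity)]
  refine le_trans ?_ h
  rw [mul_comm, pow_mul]
  gcongr
  nlinarith [abs_nonneg u, sq_abs u]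

/-- The cosine transform of `φ`. -/
def cosTransform (φ : 𝓢(ℝ, ℝ)) (s : ℝ) : ℝ := ∫ u, φ u * Real.cos (s * u)

lemma integrable_mul_cos (φ : 𝓢(ℝ, ℝ)) (s : ℝ) :
    MeasureTheory.Integrable fun u => φ u * Real.cos (s * u) := by
  refine φ.integrable.mono (by have := φ.continuous; fun_prop) (Filter.Eventually.of_forall fun u => ?_)
  rw [norm_mul]
  exact mul_le_of_le_one_right (norm_nonneg _) (Real.abs_cos_le_one _)

lemma integrable_mul_sin (φ : 𝓢(ℝ, ℝ)) (s : ℝ) :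
    MeasureTheory.Integrable fun u => φ u * Real.sin (s * u) := by
  refine φ.integrable.mono (by have := φ.continuous; fun_prop) (Filter.Eventually.of_forall fun u => ?_)
  rw [norm_mul]
  exact mul_le_of_le_one_right (norm_nonneg _) (Real.abs_sin_le_one _)

lemma continuous_cosTransform (φ : 𝓢(ℝ, ℝ)) : Continuous (cosTransform φ) := by
  have := φ.continuous
  refine MeasureTheory.continuous_of_dominated (bound := fun u => ‖φ u‖)
    (fun s => (integrable_mul_cos φ s).aestronglyMeasurable)
    (fun s => Filter.Eventually.of_forall fun u => ?_) φ.integrable.norm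
    (Filter.Eventually.of_forall fun u => by fun_prop)
  rw [norm_mul]
  exact mul_le_of_le_one_right (norm_nonneg _) (Real.abs_cos_le_one _)

lemma abs_cosTransform_le (φ : 𝓢(ℝ, ℝ)) (s : ℝ) : |cosTransform φ s| ≤ ∫ u, |φ u| := by
  refine (MeasureTheory.abs_integral_le_integral_abs).trans ?_
  refine MeasureTheory.integral_mono (integrable_mul_cos φ s).abs φ.integrable.abs fun u => ?_
  simp only [abs_mul]
  exact mul_le_of_le_one_right (abs_nonneg _) (Real.abs_cos_le_one _)

lemma IsProfile.integral_mul_sin {φ : 𝓢(ℝ, ℝ)} (hφ : IsProfile φ) (s : ℝ) :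
    ∫ u, φ u * Real.sin (s * u) = 0 := by
  have h := MeasureTheory.integral_neg_eq_self (fun u => φ u * Real.sin (s * u)) MeasureTheory.volume
  simp only [hφ.even, mul_neg, Real.sin_neg, MeasureTheory.integral_neg] at h
  linarith

lemma IsProfile.fourier_dilation {φ : 𝓢(ℝ, ℝ)} (hφ : IsProfile φ) {t : ℝ} (ht : 0 < t) (n : ℤ) :
    FourierTransform.fourier (fun y : ℝ => (φ (2 * Real.pi * t * y) : ℂ)) (n : ℝ)
      = (((2 * Real.pi * t)⁻¹ * cosTransform φ (n / t) : ℝ) : ℂ) := by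
  have hpi := Real.pi_pos
  rw [Real.fourier_real_eq_integral_exp_smul]
  let h : ℝ → ℂ := fun u => ((φ u * Real.cos (n / t * u) : ℝ) : ℂ)
    - ((φ u * Real.sin (n / t * u) : ℝ) : ℂ) * Complex.I
  have e : ∀ v : ℝ, Complex.exp (((-2 * Real.pi * v * (n : ℝ) : ℝ) : ℂ) * Complex.I) •
      (φ (2 * Real.pi * t * v) : ℂ) = h (2 * Real.pi * t * v) := by
    intro v
    simp only [h]
    have e1 : -2 * Real.pi * v * (n : ℝ) = -(n / t * (2 * Real.pi * t * v)) := by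
      field_simp
    rw [e1, Complex.exp_mul_I, ← Complex.ofReal_cos, ← Complex.ofReal_sin, Real.cos_neg, Real.sin_neg]
    push_cast
    simp only [smul_eq_mul]
    ring
  rw [MeasureTheory.integral_congr_ae (Filter.Eventually.of_forall e)]
  rw [MeasureTheory.Measure.integral_comp_mul_left h, MeasureTheory.integral_sub
    (integrable_mul_cos φ _).ofReal ((integrable_mul_sin φ _).ofReal.mul_const _),
    MeasureTheory.integral_mul_const, integral_complex_ofReal, integral_complex_ofReal, hφ.integral_mul_sin,
    abs_of_pos (by positivity)]
  simp [cosTransform]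

lemma IsProfile.cosTransform_eq_zero {φ : 𝓢(ℝ, ℝ)} (hφ : IsProfile φ) {s : ℝ} (hs : 1 < |s|) :
    cosTransform φ s = 0 := hφ.fourier_support s hs

lemma summable_periodisation (φ : 𝓢(ℝ, ℝ)) {t : ℝ} (ht : 0 < t) {θ : ℝ} (h0 : 0 ≤ θ)
    (hpi : θ ≤ Real.pi) : Summable fun n : ℤ => φ ((θ - 2 * Real.pi * n) * t) := by
  obtain ⟨K, hK, h⟩ := exists_decay φ 1
  have hs : Summable fun n : ℤ => K / t ^ 2 * (1 / (n : ℝ) ^ 2) :=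
    (Real.summable_one_div_int_pow.2 one_lt_two).mul_left _
  refine Summable.of_norm_bounded_eventually hs ?_
  have : ∀ᶠ n : ℤ in Filter.cofinite, n ≠ 0 := (Set.finite_singleton 0).compl_mem_cofinite
  filter_upwards [this] with n hn
  have hn1 : (1 : ℝ) ≤ (n : ℝ) ^ 2 := by
    have := Int.one_le_abs hn
    have h2 : (1 : ℝ) ≤ |(n : ℝ)| := by exact_mod_cast this
    nlinarith [sq_abs (n : ℝ)]
  have hsq : (n : ℝ) ^ 2 ≤ (θ - 2 * Real.pi * n) ^ 2 := by
    rw [sq_le_sq]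
    have h1 : |2 * Real.pi * (n : ℝ)| - |θ| ≤ |θ - 2 * Real.pi * n| := by
      rw [abs_sub_comm]; exact abs_sub_abs_le_abs_sub _ _
    rw [abs_mul, abs_of_pos (by positivity : 0 < 2 * Real.pi), abs_of_nonneg h0] at h1
    have h2 : (1 : ℝ) ≤ |(n : ℝ)| := by rwa [one_le_sq_iff_one_le_abs] at hn1
    nlinarith [Real.pi_gt_three]
  refine (h _).trans ?_
  rw [div_mul_div_comm, mul_one, div_eq_mul_inv, pow_one]
  gcongr
  nlinarith [sq_nonneg t, mul_le_mul_of_nonneg_right hsq (sq_nonneg t)]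

/-- Poisson summation: for `t ≤ N`, `W_t(E)` is a combination of Chebyshev polynomials of degree
at most `N` in `1 - E / 2`. -/
lemma IsProfile.spectralFn_eq_sum {φ : 𝓢(ℝ, ℝ)} (hφ : IsProfile φ) {t : ℝ} (ht : 0 < t) {N : ℕ}
    (hN : t ≤ N) {E : ℝ} (h0 : 0 ≤ E) (h4 : E ≤ 4) :
    spectralFn φ t E = (2 * Real.pi * t)⁻¹ * ∑ p ∈ Finset.Icc (-(N : ℤ)) N,
      cosTransform φ (p / t) * (Polynomial.Chebyshev.T ℝ p).eval (1 - E / 2) := by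
  have hpi := Real.pi_pos
  set θ := Real.arccos (1 - E / 2) with hθ
  have hcos : Real.cos θ = 1 - E / 2 := Real.cos_arccos (by linarith) (by linarith)
  have hzero : ∀ p : ℤ, p ∉ Finset.Icc (-(N : ℤ)) N → cosTransform φ (p / t) = 0 := by
    intro p hp
    apply hφ.cosTransform_eq_zero
    rw [abs_div, abs_of_pos ht, one_lt_div ht]
    rw [Finset.mem_Icc, ← abs_le, not_le] at hp
    have : (N : ℝ) < |(p : ℝ)| := by exact_mod_cast hp
    linarith
  have hc : Continuous fun y : ℝ => (φ (2 * Real.pi * t * y) : ℂ) := by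
    have := φ.continuous
    fun_prop
  have hO : (fun y : ℝ => (φ (2 * Real.pi * t * y) : ℂ)) =O[Filter.cocompact ℝ]
      fun x : ℝ => |x| ^ (-2 : ℝ) := by
    obtain ⟨K, hK, h⟩ := exists_decay φ 1
    refine Asymptotics.IsBigO.of_bound (K / (2 * Real.pi * t) ^ 2) ?_
    have h1 : ∀ᶠ y : ℝ in Filter.cocompact ℝ, y ∉ ({0} : Set ℝ) := isCompact_singleton.compl_mem_cocompact
    filter_upwards [h1] with y hy
    have hy : y ≠ 0 := hy
    have hy2 : 0 < y ^ 2 := by positivity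
    rw [Complex.norm_real, Real.norm_eq_abs, Real.norm_eq_abs (|y| ^ (-2 : ℝ)),
      Real.rpow_neg (abs_nonneg y), Real.rpow_two, sq_abs, abs_of_pos (inv_pos.2 hy2)]
    refine (h _).trans ?_
    rw [pow_one, div_eq_mul_inv, mul_assoc K, ← mul_inv, ← mul_pow]
    gcongr
    linarith
  have hF : Summable fun n : ℤ => FourierTransform.fourier (fun y : ℝ => (φ (2 * Real.pi * t * y) : ℂ)) (n : ℝ) := by
    refine summable_of_ne_finset_zero (s := Finset.Icc (-(N : ℤ)) N) fun p hp => ?_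
    rw [hφ.fourier_dilation ht, hzero p hp]
    simp
  have key := Real.tsum_eq_tsum_fourier_of_rpow_decay_of_summable hc one_lt_two hO hF (θ / (2 * Real.pi))
  have hL : ∑' n : ℤ, (φ (2 * Real.pi * t * (θ / (2 * Real.pi) + n)) : ℂ) = (spectralFn φ t E : ℂ) := by
    rw [spectralFn, Complex.ofReal_tsum, ← (Equiv.neg ℤ).tsum_eq]
    refine tsum_congr fun n => ?_
    congr 2
    simp only [Equiv.neg_apply]
    rw [← hθ]
    push_cast
    field_simp
    ring
  rw [hL, tsum_eq_sum (s := Finset.Icc (-(N : ℤ)) N)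
    (fun p hp => by rw [hφ.fourier_dilation ht, hzero p hp]; simp)] at key
  have hre := congrArg Complex.re key
  rw [Complex.ofReal_re, Complex.re_sum] at hre
  rw [hre, Finset.mul_sum]
  refine Finset.sum_congr rfl fun p _ => ?_
  rw [hφ.fourier_dilation ht, fourier_coe_apply, ← hcos, Polynomial.Chebyshev.T_real_cos]
  have e : 2 * (Real.pi : ℂ) * Complex.I * p * ((θ / (2 * Real.pi) : ℝ) : ℂ) / ((1 : ℝ) : ℂ)
      = ((p * θ : ℝ) : ℂ) * Complex.I := by
    have : (Real.pi : ℂ) ≠ 0 := by exact_mod_cast hpi.ne'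
    push_cast
    field_simp
  rw [e, Complex.re_ofReal_mul, Complex.exp_ofReal_mul_I_re]
  ring

lemma IsProfile.spectralFn_nonneg {φ : 𝓢(ℝ, ℝ)} (hφ : IsProfile φ) (t E : ℝ) :
    0 ≤ spectralFn φ t E := tsum_nonneg fun _ => hφ.nonneg _

/-- The term `n = 0` bounds `W_t` from below. -/
lemma IsProfile.le_spectralFn {φ : 𝓢(ℝ, ℝ)} (hφ : IsProfile φ) {t : ℝ} (ht : 0 < t) (E : ℝ) :
    φ (Real.arccos (1 - E / 2) * t) ≤ spectralFn φ t E := by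
  have h := (summable_periodisation φ ht (Real.arccos_nonneg (1 - E / 2)) (Real.arccos_le_pi _)).le_tsum
    0 fun _ _ => hφ.nonneg _
  simpa [spectralFn] using h

lemma IsProfile.mul_spectralFn_le {φ : 𝓢(ℝ, ℝ)} (hφ : IsProfile φ) :
    ∃ K, 0 ≤ K ∧ ∀ t E : ℝ, 0 < t → 0 ≤ E → E ≤ 4 → t * spectralFn φ t E ≤ K * (1 + t) := by
  refine ⟨3 * ∫ u, |φ u|, by positivity, fun t E ht h0 h4 => ?_⟩
  set A := ∫ u, |φ u|
  have hA : 0 ≤ A := by positivity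
  have hpi := Real.pi_gt_three
  rw [hφ.spectralFn_eq_sum ht (Nat.le_ceil t) h0 h4]
  have hb : ∑ p ∈ Finset.Icc (-(⌈t⌉₊ : ℤ)) ⌈t⌉₊,
      cosTransform φ (p / t) * (Polynomial.Chebyshev.T ℝ p).eval (1 - E / 2)
      ≤ ∑ _p ∈ Finset.Icc (-(⌈t⌉₊ : ℤ)) ⌈t⌉₊, A := by
    refine Finset.sum_le_sum fun p _ => (le_abs_self _).trans ?_
    rw [abs_mul, ← Real.cos_arccos (x := 1 - E / 2) (by linarith) (by linarith),
      Polynomial.Chebyshev.T_real_cos]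
    exact (mul_le_of_le_one_right (abs_nonneg _) (Real.abs_cos_le_one _)).trans
      (abs_cosTransform_le φ _)
  have hcard : ∑ _p ∈ Finset.Icc (-(⌈t⌉₊ : ℤ)) ⌈t⌉₊, A = (2 * ⌈t⌉₊ + 1) * A := by
    rw [Finset.sum_const, Int.card_Icc, nsmul_eq_mul]
    congr 1
    have : ((⌈t⌉₊ : ℤ) + 1 - -(⌈t⌉₊ : ℤ)).toNat = 2 * ⌈t⌉₊ + 1 := by lia
    rw [this]; push_cast; ring
  rw [hcard] at hb
  have hceil := Nat.ceil_lt_add_one ht.le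
  rw [mul_inv, mul_assoc, mul_left_comm t, mul_inv_cancel_left₀ ht.ne']
  have h1 : (2 * Real.pi)⁻¹ ≤ 1 := inv_le_one_of_one_le₀ (by linarith)
  have h2 : (2 * (⌈t⌉₊ : ℝ) + 1) * A ≤ 3 * A * (1 + t) := by nlinarith
  have h3 : 0 ≤ 3 * A * (1 + t) := by positivity
  calc _ ≤ (2 * Real.pi)⁻¹ * (3 * A * (1 + t)) := by gcongr; exact hb.trans h2
    _ ≤ _ := mul_le_of_le_one_left h3 h1

lemma spectralFn_le (φ : 𝓢(ℝ, ℝ)) (N : ℕ) :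
    ∃ K, 0 ≤ K ∧ ∀ t E : ℝ, 1 ≤ t → 0 ≤ E → E ≤ 4 →
      spectralFn φ t E ≤ K * ((1 + E * t ^ 2) ^ N)⁻¹ := by
  obtain ⟨K, hK, h⟩ := exists_decay φ (N + 1)
  have hsum : Summable fun n : ℤ => (1 + (n : ℝ) ^ 2)⁻¹ := by
    refine Summable.of_norm_bounded_eventually (Real.summable_one_div_int_pow.2 one_lt_two) ?_
    have : ∀ᶠ n : ℤ in Filter.cofinite, n ≠ 0 := (Set.finite_singleton 0).compl_mem_cofinite
    filter_upwards [this] with n hn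
    have : (0 : ℝ) < (n : ℝ) ^ 2 := by positivity
    rw [Real.norm_of_nonneg (by positivity), one_div]
    gcongr
    linarith
  refine ⟨K * ∑' n : ℤ, (1 + (n : ℝ) ^ 2)⁻¹, mul_nonneg hK (tsum_nonneg fun n => by positivity),
    fun t E ht h0 h4 => ?_⟩
  have hpi := Real.pi_gt_three
  have hθ0 := Real.arccos_nonneg (1 - E / 2)
  have hθpi := Real.arccos_le_pi (1 - E / 2)
  have hcos : Real.cos (Real.arccos (1 - E / 2)) = 1 - E / 2 :=
    Real.cos_arccos (by linarith) (by linarith)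
  unfold spectralFn
  set θ := Real.arccos (1 - E / 2)
  have hE : E ≤ θ ^ 2 := by
    have := Real.one_sub_sq_div_two_le_cos (x := θ)
    linarith
  have hterm : ∀ n : ℤ, φ ((θ - 2 * Real.pi * n) * t)
      ≤ K * ((1 + E * t ^ 2) ^ N)⁻¹ * (1 + (n : ℝ) ^ 2)⁻¹ := by
    intro n
    have hn : |(n : ℝ)| ≤ |θ - 2 * Real.pi * n| ∧ |θ| ≤ |θ - 2 * Real.pi * n| := by
      rcases eq_or_ne n 0 with rfl | hn
      · simp
      have h2 : (1 : ℝ) ≤ |(n : ℝ)| := by exact_mod_cast Int.one_le_abs hn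
      have h1 : |2 * Real.pi * (n : ℝ)| - |θ| ≤ |θ - 2 * Real.pi * n| := by
        rw [abs_sub_comm]; exact abs_sub_abs_le_abs_sub _ _
      rw [abs_mul, abs_of_pos (by positivity : 0 < 2 * Real.pi), abs_of_nonneg hθ0] at h1
      rw [abs_of_nonneg hθ0]
      constructor <;> nlinarith
    have hs1 := sq_le_sq.2 hn.1
    have hs2 := hE.trans (sq_le_sq.2 hn.2)
    have ht2 : 1 ≤ t ^ 2 := one_le_pow₀ ht
    refine (le_abs_self _).trans ((h _).trans ?_)
    rw [mul_assoc K, ← mul_inv, pow_succ, mul_pow]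
    gcongr
    nlinarith [sq_nonneg (n : ℝ)]
  calc _ ≤ ∑' n : ℤ, K * ((1 + E * t ^ 2) ^ N)⁻¹ * (1 + (n : ℝ) ^ 2)⁻¹ :=
        (summable_periodisation φ (by linarith) hθ0 hθpi).tsum_le_tsum hterm (hsum.mul_left _)
    _ = _ := by rw [tsum_mul_left]; ring

/-! ### The covariances as finite combinations of Chebyshev modes -/

/-- The Fourier coefficients of `T_p(1 - E/2)`, where `E = (λ(k) + m²) / R` is the rescaled symbol
of `-Δ + m²`. -/
def chebCoeff (R m2 : ℝ) (p : ℤ) (x : Lattice) : ℝ :=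
  latticeCoeff (fun k => (Polynomial.Chebyshev.T ℝ p).eval (1 - (laplaceSymbol k + m2) / R / 2)) x

/-- The symbol `F_t(k) = (t²/R) W_t((λ(k) + m²)/R)` whose Fourier coefficients are
`scaleKernel`. -/
def scaleSymbol (φ : 𝓢(ℝ, ℝ)) (R t m2 : ℝ) (k : Fin 4 → ℝ) : ℝ :=
  t ^ 2 / R * spectralFn φ t ((laplaceSymbol k + m2) / R)

lemma scaleKernel_eq_latticeCoeff (φ : 𝓢(ℝ, ℝ)) (R t m2 : ℝ) (x : Lattice) :
    scaleKernel φ R t m2 x = latticeCoeff (scaleSymbol φ R t m2) x := rfl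

/-- The lower end of the interval of scales `t` that defines `cov φ R L m2 j`. -/
def scaleStart (L j : ℕ) : ℝ := if j ≤ 1 then 0 else (L : ℝ) ^ (j - 1) / 2

lemma cov_eq (φ : 𝓢(ℝ, ℝ)) (R : ℝ) (L : ℕ) (m2 : ℝ) (j : ℕ) (x : Lattice) :
    cov φ R L m2 j x = ∫ t in scaleStart L j..((L : ℝ) ^ j / 2), scaleKernel φ R t m2 x / t := rfl

lemma scaleStart_nonneg (L j : ℕ) : 0 ≤ scaleStart L j := by
  unfold scaleStart; split_ifs <;> positivity

lemma scaleStart_le {L : ℕ} (hL : 1 ≤ L) (j : ℕ) : scaleStart L j ≤ (L : ℝ) ^ j / 2 := by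
  unfold scaleStart
  split_ifs
  · positivity
  · have : (1 : ℝ) ≤ L := by exact_mod_cast hL
    exact div_le_div_of_nonneg_right (pow_le_pow_right₀ this (j.sub_le 1)) zero_le_two

lemma chebMode_mem (R m2 : ℝ) {p : ℤ} {N : ℕ} (hp : p ∈ Finset.Icc (-(N : ℤ)) N) :
    (fun k => (Polynomial.Chebyshev.T ℝ p).eval (1 - (laplaceSymbol k + m2) / R / 2)) ∈ trigPoly N := by
  have hd : (Polynomial.Chebyshev.T ℝ p).natDegree ≤ N := by
    rw [Polynomial.Chebyshev.natDegree_T]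
    rw [Finset.mem_Icc] at hp
    lia
  have e : ∀ k, 1 - (laplaceSymbol k + m2) / R / 2
      = 1 - m2 / R / 2 + -(1 / R / 2) * laplaceSymbol k := fun k => by ring
  simp only [e]
  exact eval_mem_trigPoly _ _ hd

lemma continuous_chebCoeff (R : ℝ) (p : ℤ) (x : Lattice) :
    Continuous fun m2 => chebCoeff R m2 p x := by
  unfold chebCoeff latticeCoeff
  refine continuous_const.mul (continuous_parametric_integral_of_continuous ?_ isCompact_torus)
  unfold Function.uncurry
  have h1 := (Polynomial.Chebyshev.T ℝ p).continuous
  have h2 := continuous_laplaceSymbol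
  have h3 := continuous_dot x
  fun_prop

lemma energy_mem {R m2 : ℝ} (hm : 0 ≤ m2) (hR : 16 + m2 ≤ 4 * R) (k : Fin 4 → ℝ) :
    0 ≤ (laplaceSymbol k + m2) / R ∧ (laplaceSymbol k + m2) / R ≤ 4 := by
  have h1 := laplaceSymbol_nonneg k
  have h2 := laplaceSymbol_le k
  have hR0 : 0 < R := by linarith
  exact ⟨by positivity, by rw [div_le_iff₀ hR0]; linarith⟩

section Covariance

variable {φ : 𝓢(ℝ, ℝ)} (hφ : IsProfile φ) {R m2 : ℝ} (hm : 0 ≤ m2) (hR : 16 + m2 ≤ 4 * R)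

include hφ hm hR

lemma IsProfile.scaleSymbol_eq_sum {t : ℝ} (ht : 0 < t) {N : ℕ} (hN : t ≤ N) :
    scaleSymbol φ R t m2 = ∑ p ∈ Finset.Icc (-(N : ℤ)) N,
      (t * ((2 * Real.pi * R)⁻¹ * cosTransform φ (p / t))) •
        fun k => (Polynomial.Chebyshev.T ℝ p).eval (1 - (laplaceSymbol k + m2) / R / 2) := by
  funext k
  obtain ⟨h0, h4⟩ := energy_mem hm hR k
  have hR0 : R ≠ 0 := by linarith
  have hpi := Real.pi_ne_zero
  rw [scaleSymbol, hφ.spectralFn_eq_sum ht hN h0 h4]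
  simp only [Finset.sum_apply, Pi.smul_apply, smul_eq_mul, Finset.mul_sum]
  refine Finset.sum_congr rfl fun p _ => ?_
  field_simp

lemma IsProfile.scaleSymbol_mem {t : ℝ} (ht : 0 < t) {N : ℕ} (hN : t ≤ N) :
    scaleSymbol φ R t m2 ∈ trigPoly N := by
  rw [hφ.scaleSymbol_eq_sum hm hR ht hN]
  exact (trigPoly N).sum_mem fun p hp => (trigPoly N).smul_mem _ (chebMode_mem R m2 hp)

lemma IsProfile.continuous_scaleSymbol {t : ℝ} (ht : 0 < t) : Continuous (scaleSymbol φ R t m2) :=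
  continuous_of_mem_trigPoly (hφ.scaleSymbol_mem hm hR ht (Nat.le_ceil t))

lemma IsProfile.scaleKernel_div_eq_sum {t : ℝ} (ht : 0 < t) {N : ℕ} (hN : t ≤ N) (x : Lattice) :
    scaleKernel φ R t m2 x / t = ∑ p ∈ Finset.Icc (-(N : ℤ)) N,
      (2 * Real.pi * R)⁻¹ * cosTransform φ (p / t) * chebCoeff R m2 p x := by
  rw [scaleKernel_eq_latticeCoeff, hφ.scaleSymbol_eq_sum hm hR ht hN]
  have hs : ∀ S ⊆ Finset.Icc (-(N : ℤ)) N, latticeCoeff (∑ p ∈ S,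
      (t * ((2 * Real.pi * R)⁻¹ * cosTransform φ (p / t))) •
        fun k => (Polynomial.Chebyshev.T ℝ p).eval (1 - (laplaceSymbol k + m2) / R / 2)) x
      = ∑ p ∈ S, t * ((2 * Real.pi * R)⁻¹ * cosTransform φ (p / t)) * chebCoeff R m2 p x := by
    intro S hS
    induction S using Finset.induction_on with
    | empty => simp [latticeCoeff_zero]
    | insert p S hp ih =>
      have hmem : ∀ q ∈ insert p S, (t * ((2 * Real.pi * R)⁻¹ * cosTransform φ (q / t))) •
        (fun k => (Polynomial.Chebyshev.T ℝ q).eval (1 - (laplaceSymbol k + m2) / R / 2))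
          ∈ trigPoly N := fun q hq => (trigPoly N).smul_mem _ (chebMode_mem R m2 (hS hq))
      rw [Finset.sum_insert hp, Finset.sum_insert hp, latticeCoeff_add
        (continuous_of_mem_trigPoly (hmem p (Finset.mem_insert_self _ _)))
        (continuous_of_mem_trigPoly ((trigPoly N).sum_mem fun q hq =>
          hmem q (Finset.mem_insert_of_mem hq))),
        latticeCoeff_smul, ih ((Finset.subset_insert _ _).trans hS), chebCoeff]
  rw [hs _ subset_rfl, Finset.sum_div]
  refine Finset.sum_congr rfl fun p _ => ?_
  field_simp

omit hφ hm hR in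
lemma intervalIntegrable_cosTransform_div (φ : 𝓢(ℝ, ℝ)) (p : ℤ) (a b : ℝ) :
    IntervalIntegrable (fun t => cosTransform φ (p / t)) MeasureTheory.volume a b := by
  rw [intervalIntegrable_iff]
  refine MeasureTheory.Measure.integrableOn_of_bounded (M := ∫ u, |φ u|) (by simp) ?_
    (Filter.Eventually.of_forall fun t => by simpa using abs_cosTransform_le φ _)
  exact ((continuous_cosTransform φ).measurable.comp
    (measurable_const.div measurable_id)).aestronglyMeasurable

lemma IsProfile.intervalIntegrable_scaleKernel_div {a b : ℝ} (ha : 0 ≤ a) (hab : a ≤ b) (x : Lattice) :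
    IntervalIntegrable (fun t => scaleKernel φ R t m2 x / t) MeasureTheory.volume a b := by
  have h : IntervalIntegrable (fun t => ∑ p ∈ Finset.Icc (-(⌈b⌉₊ : ℤ)) ⌈b⌉₊,
      (2 * Real.pi * R)⁻¹ * cosTransform φ (p / t) * chebCoeff R m2 p x) MeasureTheory.volume a b := by
    have := IntervalIntegrable.sum (Finset.Icc (-(⌈b⌉₊ : ℤ)) ⌈b⌉₊) (f := fun (p : ℤ) t =>
      (2 * Real.pi * R)⁻¹ * cosTransform φ (p / t) * chebCoeff R m2 p x)
      fun p _ => ((intervalIntegrable_cosTransform_div φ p a b).const_mul _).mul_const _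
    simpa [Finset.sum_fn] using this
  refine h.congr fun t ht => ?_
  rw [Set.uIoc_of_le hab] at ht
  exact (hφ.scaleKernel_div_eq_sum hm hR (ha.trans_lt ht.1) (ht.2.trans (Nat.le_ceil b)) x).symm

/-- Separation of variables: the mass and the lattice point enter the covariance only through the
Fourier coefficients `chebCoeff`, and only finitely many of them occur. -/
lemma IsProfile.cov_eq_sum {L : ℕ} (hL : 1 ≤ L) (j : ℕ) (x : Lattice) :
    cov φ R L m2 j x = ∑ p ∈ Finset.Icc (-((L ^ j : ℕ) : ℤ)) (L ^ j : ℕ),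
      ((2 * Real.pi * R)⁻¹ * ∫ t in scaleStart L j..((L : ℝ) ^ j / 2), cosTransform φ (p / t))
        * chebCoeff R m2 p x := by
  rw [cov_eq]
  have h : ∀ t ∈ Set.uIoc (scaleStart L j) ((L : ℝ) ^ j / 2), scaleKernel φ R t m2 x / t =
      ∑ p ∈ Finset.Icc (-((L ^ j : ℕ) : ℤ)) (L ^ j : ℕ),
      (2 * Real.pi * R)⁻¹ * cosTransform φ (p / t) * chebCoeff R m2 p x := by
    intro t ht
    rw [Set.uIoc_of_le (scaleStart_le hL j)] at ht
    refine hφ.scaleKernel_div_eq_sum hm hR ((scaleStart_nonneg L j).trans_lt ht.1) ?_ x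
    have : (0 : ℝ) ≤ (L : ℝ) ^ j := by positivity
    push_cast
    linarith [ht.2]
  rw [intervalIntegral.integral_congr_ae (Filter.Eventually.of_forall h),
    intervalIntegral.integral_finsetSum
    fun p _ => ((intervalIntegrable_cosTransform_div φ p _ _).const_mul _).mul_const _]
  simp only [intervalIntegral.integral_mul_const, intervalIntegral.integral_const_mul]

/-- The covariances have finite range. -/
lemma IsProfile.cov_eq_zero {L : ℕ} (hL : 1 ≤ L) {j : ℕ} {x : Lattice} (hx : x ∉ box (L ^ j)) :
    cov φ R L m2 j x = 0 := by
  rw [hφ.cov_eq_sum hm hR hL]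
  refine Finset.sum_eq_zero fun p hp => ?_
  rw [chebCoeff, latticeCoeff_eq_zero (chebMode_mem R m2 hp) hx, mul_zero]

omit hφ hm hR in
lemma IsProfile.continuousOn_cov (hφ : IsProfile φ) {mbar2 : ℝ} (hR : 16 + mbar2 ≤ 4 * R) {L : ℕ}
    (hL : 1 ≤ L) (j : ℕ) (x : Lattice) :
    ContinuousOn (fun m2 => cov φ R L m2 j x) (Set.Icc 0 mbar2) := by
  have h : Continuous fun m2 => ∑ p ∈ Finset.Icc (-((L ^ j : ℕ) : ℤ)) (L ^ j : ℕ),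
      ((2 * Real.pi * R)⁻¹ * ∫ t in scaleStart L j..((L : ℝ) ^ j / 2), cosTransform φ (p / t))
        * chebCoeff R m2 p x :=
    continuous_finsetSum _ fun p _ => continuous_const.mul (continuous_chebCoeff R p x)
  exact h.continuousOn.congr fun m2 hm2 => hφ.cov_eq_sum hm2.1 (by linarith [hm2.2]) hL j x

/-! ### Positivity and the lower bound -/

omit hφ hm in
lemma IsProfile.scaleSymbol_nonneg (hφ : IsProfile φ) (hm : 0 ≤ m2) (t : ℝ) (k : Fin 4 → ℝ) :
    0 ≤ scaleSymbol φ R t m2 k :=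
  mul_nonneg (div_nonneg (sq_nonneg t) (by linarith)) (hφ.spectralFn_nonneg _ _)

omit hφ hm hR in
lemma sum_mul_latticeCoeff {F : (Fin 4 → ℝ) → ℝ} (hF : Continuous F) {ι : Type*} (S : Finset ι)
    (v : ι → ℝ) (y : ι → Lattice) :
    ∑ i ∈ S, v i * latticeCoeff F (y i)
      = ((2 * Real.pi) ^ 4)⁻¹ * ∫ k in torus, F k * ∑ i ∈ S, v i * Real.cos (dot k (y i)) := by
  simp only [Finset.mul_sum]
  rw [MeasureTheory.integral_finsetSum S
    fun i _ => Continuous.integrableOn_torus (by fun_prop), Finset.mul_sum]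
  refine Finset.sum_congr rfl fun i _ => ?_
  rw [latticeCoeff, ← mul_assoc, mul_comm (v i), mul_assoc, ← MeasureTheory.integral_const_mul]
  congr 2
  funext k
  ring

/-- A finite combination of values of the covariance, as an integral over the scales. -/
lemma IsProfile.sum_mul_cov {L : ℕ} (hL : 1 ≤ L) (j : ℕ) {ι : Type*} (S : Finset ι)
    (v : ι → ℝ) (y : ι → Lattice) :
    ∑ i ∈ S, v i * cov φ R L m2 j (y i)
      = ∫ t in scaleStart L j..((L : ℝ) ^ j / 2), ∑ i ∈ S, v i * (scaleKernel φ R t m2 (y i) / t) := by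
  rw [intervalIntegral.integral_finsetSum fun i _ =>
    (hφ.intervalIntegrable_scaleKernel_div hm hR (scaleStart_nonneg L j) (scaleStart_le hL j)
      (y i)).const_mul _]
  simp only [intervalIntegral.integral_const_mul, cov_eq]

/-- The Fourier transform of the covariance. -/
lemma IsProfile.sum_cov_mul_cos {L : ℕ} (hL : 1 ≤ L) {j n : ℕ} (hn : L ^ j ≤ n) (k : Fin 4 → ℝ) :
    ∑ x ∈ box n, cov φ R L m2 j x * Real.cos (dot k x)
      = ∫ t in scaleStart L j..((L : ℝ) ^ j / 2), scaleSymbol φ R t m2 k / t := by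
  have h := hφ.sum_mul_cov hm hR hL j (box n) (fun x => Real.cos (dot k x)) id
  simp only [id] at h
  simp only [mul_comm (cov φ R L m2 j _), h]
  refine intervalIntegral.integral_congr_ae (Filter.Eventually.of_forall fun t ht => ?_)
  rw [Set.uIoc_of_le (scaleStart_le hL j)] at ht
  have ht0 : 0 < t := (scaleStart_nonneg L j).trans_lt ht.1
  have htn : t ≤ n := by
    have h1 : ((L ^ j : ℕ) : ℝ) ≤ n := by exact_mod_cast hn
    have h2 : (0 : ℝ) ≤ (L : ℝ) ^ j := by positivity
    push_cast at h1
    linarith [ht.2]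
  rw [← sum_latticeCoeff_mul_cos (hφ.scaleSymbol_mem hm hR ht0 htn) k, Finset.sum_div]
  exact Finset.sum_congr rfl fun x _ => by rw [scaleKernel_eq_latticeCoeff]; ring

lemma IsProfile.sum_cov_mul_cos_nonneg {L : ℕ} (hL : 1 ≤ L) {j n : ℕ} (hn : L ^ j ≤ n)
    (k : Fin 4 → ℝ) : 0 ≤ ∑ x ∈ box n, cov φ R L m2 j x * Real.cos (dot k x) := by
  rw [hφ.sum_cov_mul_cos hm hR hL hn]
  exact intervalIntegral.integral_nonneg (scaleStart_le hL j) fun t ht =>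
    div_nonneg (hφ.scaleSymbol_nonneg hR hm t k) ((scaleStart_nonneg L j).trans ht.1)

/-- Parseval: the pairing of two covariances is non-negative, since both have non-negative
Fourier transform. -/
lemma IsProfile.sum_cov_mul_cov_nonneg {L : ℕ} (hL : 1 ≤ L) {i n : ℕ} (hn : L ^ i ≤ n) (j : ℕ) :
    0 ≤ ∑ x ∈ box n, cov φ R L m2 i x * cov φ R L m2 j x := by
  have h := hφ.sum_mul_cov hm hR hL j (box n) (fun x => cov φ R L m2 i x) id
  simp only [id] at h
  rw [h, intervalIntegral.integral_of_le (scaleStart_le hL j)]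
  refine MeasureTheory.setIntegral_nonneg measurableSet_Ioc fun t ht => ?_
  have ht0 : 0 < t := (scaleStart_nonneg L j).trans_lt ht.1
  have e := sum_mul_latticeCoeff (hφ.continuous_scaleSymbol hm hR ht0) (box n)
    (fun x => cov φ R L m2 i x) id
  simp only [id] at e
  simp only [scaleKernel_eq_latticeCoeff, ← mul_div_assoc, ← Finset.sum_div, e]
  refine div_nonneg (mul_nonneg (by positivity) (MeasureTheory.setIntegral_nonneg
    measurableSet_torus fun k _ => mul_nonneg (hφ.scaleSymbol_nonneg hR hm t k)
      (hφ.sum_cov_mul_cos_nonneg hm hR hL hn k))) ht0.le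

end Covariance

lemma IsProfile.exists_pos {φ : 𝓢(ℝ, ℝ)} (hφ : IsProfile φ) : ∃ u, 0 < u ∧ 0 < φ u := by
  by_contra! h
  have h0 : ∀ t ∈ Set.Ioi (0 : ℝ), t * φ t = 0 := fun t ht => by
    rw [le_antisymm (h t ht) (hφ.nonneg t), mul_zero]
  have := hφ.normalized
  rw [MeasureTheory.setIntegral_congr_fun measurableSet_Ioi h0] at this
  simp at this

/-- Lower bound on the `ℓ²` norm of the covariance below the mass scale. By Cauchy-Schwarz it is
enough to bound the Fourier transform from below at one momentum `k`; it is chosen such that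
`arccos (1 - E/2) = u / L^j` at the energy `E` of `k`, where `φ u > 0`. -/
lemma IsProfile.exists_le_sum_cov_sq {φ : 𝓢(ℝ, ℝ)} (hφ : IsProfile φ) {R mbar2 : ℝ} (hmbar : 0 ≤ mbar2)
    (hR : 16 + mbar2 ≤ 4 * R) {L : ℕ} (hL : 2 ≤ L) :
    ∃ c ε : ℝ, ∃ j₀ : ℕ, 0 < c ∧ 0 < ε ∧ ∀ m2 ∈ Set.Icc 0 mbar2, ∀ j, j₀ ≤ j →
      m2 * (L : ℝ) ^ (2 * j) ≤ ε → c ≤ ∑ x ∈ box (L ^ (j + 1)), cov φ R L m2 (j + 1) x ^ 2 := by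
  obtain ⟨u, hu, hφu⟩ := hφ.exists_pos
  have hR0 : 0 < R := by linarith
  have hL2 : (2 : ℝ) ≤ L := by exact_mod_cast hL
  have hpi := Real.pi_pos
  set I : ℝ := ∫ τ in (1 / 2 : ℝ)..(L / 2 : ℝ), τ / R * φ (u * τ) with hI
  have hIpos : 0 < I := by
    have hcont : Continuous fun τ : ℝ => τ / R * φ (u * τ) := by
      have := φ.continuous; fun_prop
    refine intervalIntegral.integral_pos (by linarith) hcont.continuousOn (fun τ hτ => ?_)
      ⟨1, ⟨by norm_num, by linarith⟩, ?_⟩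
    · exact mul_nonneg (div_nonneg (by linarith [hτ.1]) hR0.le) (hφ.nonneg _)
    · rw [mul_one]; positivity
  obtain ⟨j₀, hj₀⟩ := exists_nat_ge (max 1 (max u (u ^ 2 * R)))
  refine ⟨I ^ 2 / (81 * L ^ 4), 4 * R / Real.pi ^ 2 * u ^ 2, j₀, by positivity, by positivity,
    fun m2 hm j hj hmj => ?_⟩
  have hR' : 16 + m2 ≤ 4 * R := by linarith [hm.2]
  have hj1 : (j₀ : ℝ) ≤ j := by exact_mod_cast hj
  have hone : 1 ≤ j := by
    have : (1 : ℝ) ≤ j := (le_max_left _ _).trans (hj₀.trans hj1)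
    exact_mod_cast this
  have hLj : (j : ℝ) ≤ (L : ℝ) ^ j := by
    exact_mod_cast (Nat.lt_pow_self (by lia : 1 < L)).le
  set ℓ : ℝ := (L : ℝ) ^ j with hℓ
  have hℓ1 : 1 ≤ ℓ := one_le_pow₀ (by linarith)
  have hℓu : u ≤ ℓ := ((le_max_left _ _).trans (le_max_right _ _)).trans (hj₀.trans (hj1.trans hLj))
  have hℓR : u ^ 2 * R ≤ ℓ :=
    ((le_max_right _ _).trans (le_max_right _ _)).trans (hj₀.trans (hj1.trans hLj))
  set ξ : ℝ := u / ℓ with hξ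
  have hξ0 : 0 < ξ := by positivity
  have hξ1 : ξ ≤ 1 := (div_le_one (by linarith)).2 hℓu
  have hξpi : ξ ≤ Real.pi := by linarith [Real.pi_gt_three]
  set E : ℝ := 2 * (1 - Real.cos ξ) with hE
  have hEle : E ≤ ξ ^ 2 := by linarith [Real.one_sub_sq_div_two_le_cos (x := ξ)]
  have hEge : 4 / Real.pi ^ 2 * ξ ^ 2 ≤ E := by
    have h := Real.cos_le_one_sub_mul_cos_sq (x := ξ) (by rwa [abs_of_pos hξ0])
    have e : 4 / Real.pi ^ 2 * ξ ^ 2 = 2 * (2 / Real.pi ^ 2 * ξ ^ 2) := by ring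
    linarith
  have hRE : R * E ≤ 4 := by
    have h1 : ξ ^ 2 * R ≤ 1 := by
      rw [hξ, div_pow, div_mul_eq_mul_div, div_le_one (by positivity)]
      nlinarith
    nlinarith
  have hmE : m2 ≤ R * E := by
    have h1 : m2 ≤ 4 * R / Real.pi ^ 2 * u ^ 2 / ℓ ^ 2 := by
      rw [le_div_iff₀ (by positivity)]
      rwa [mul_comm 2 j, pow_mul] at hmj
    calc m2 ≤ _ := h1
      _ = R * (4 / Real.pi ^ 2 * ξ ^ 2) := by rw [hξ]; field_simp
      _ ≤ _ := by gcongr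
  set k : Fin 4 → ℝ := Pi.single 0 (Real.arccos (1 - (R * E - m2) / 2)) with hk
  have hlk : laplaceSymbol k = R * E - m2 := by
    have h1 : Real.cos (k 0) = 1 - (R * E - m2) / 2 := by
      rw [hk, Pi.single_eq_same]
      exact Real.cos_arccos (by linarith [hm.1]) (by linarith)
    rw [laplaceSymbol, Fin.sum_univ_four, h1]
    simp [hk]
    ring
  have hen : (laplaceSymbol k + m2) / R = E := by rw [hlk]; field_simp; ring
  have harc : Real.arccos (1 - E / 2) = ξ := by
    rw [show 1 - E / 2 = Real.cos ξ by rw [hE]; ring]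
    exact Real.arccos_cos hξ0.le hξpi
  have hstart : scaleStart L (j + 1) = ℓ * (1 / 2) := by
    rw [scaleStart, if_neg (by lia)]; simp [hℓ]; ring
  have hend : (L : ℝ) ^ (j + 1) / 2 = ℓ * (L / 2) := by rw [hℓ, pow_succ]; ring
  have hle := scaleStart_le (by lia : 1 ≤ L) (j + 1)
  -- the Fourier transform at `k` is at least `ℓ² I`
  have hlow : ℓ ^ 2 * I ≤ ∑ x ∈ box (L ^ (j + 1)), cov φ R L m2 (j + 1) x * Real.cos (dot k x) := by
    have hint : IntervalIntegrable (fun t => scaleSymbol φ R t m2 k / t) MeasureTheory.volume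
        (scaleStart L (j + 1)) ((L : ℝ) ^ (j + 1) / 2) := by
      have h1 := IntervalIntegrable.sum (box (L ^ (j + 1))) (f := fun x t =>
        scaleKernel φ R t m2 x / t * Real.cos (dot k x)) fun x _ =>
        (hφ.intervalIntegrable_scaleKernel_div hm.1 hR' (scaleStart_nonneg L (j + 1)) hle x).mul_const _
      refine h1.congr fun t ht => ?_
      rw [Set.uIoc_of_le hle] at ht
      have ht0 : 0 < t := (scaleStart_nonneg L _).trans_lt ht.1
      have htn : t ≤ (L ^ (j + 1) : ℕ) := by
        have h2 : (0 : ℝ) ≤ (L : ℝ) ^ (j + 1) := by positivity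
        push_cast
        linarith [ht.2]
      simp only [Finset.sum_apply]
      rw [← sum_latticeCoeff_mul_cos (hφ.scaleSymbol_mem hm.1 hR' ht0 htn) k, Finset.sum_div]
      exact Finset.sum_congr rfl fun x _ => by rw [scaleKernel_eq_latticeCoeff]; ring
    rw [hφ.sum_cov_mul_cos hm.1 hR' (by lia) le_rfl]
    have hcont : Continuous fun t : ℝ => t / R * φ (ξ * t) := by
      have := φ.continuous; fun_prop
    have hscale : ℓ ^ 2 * I = ∫ t in scaleStart L (j + 1)..((L : ℝ) ^ (j + 1) / 2), t / R * φ (ξ * t) := by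
      rw [hstart, hend, ← intervalIntegral.mul_integral_comp_mul_left, hI, sq, mul_assoc,
        ← intervalIntegral.integral_const_mul]
      congr 2
      funext τ
      rw [show ξ * (ℓ * τ) = u * τ by rw [hξ]; field_simp]
      ring
    rw [hscale]
    refine intervalIntegral.integral_mono_on hle (hcont.intervalIntegrable _ _) hint fun t ht => ?_
    have ht0 : 0 < t := by
      have : 0 < scaleStart L (j + 1) := by rw [hstart]; positivity
      linarith [ht.1]
    have h1 := hφ.le_spectralFn ht0 E
    rw [harc] at h1
    have e : scaleSymbol φ R t m2 k / t = t / R * spectralFn φ t E := by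
      rw [scaleSymbol, hen]; field_simp
    rw [e]
    gcongr
  have hcs := Finset.sum_mul_sq_le_sq_mul_sq (box (L ^ (j + 1))) (fun x => cov φ R L m2 (j + 1) x)
    (fun x => Real.cos (dot k x))
  have hcard : ∑ x ∈ box (L ^ (j + 1)), Real.cos (dot k x) ^ 2 ≤ 81 * L ^ 4 * ℓ ^ 4 := by
    calc _ ≤ ∑ _x ∈ box (L ^ (j + 1)), (1 : ℝ) := Finset.sum_le_sum fun x _ => Real.cos_sq_le_one _
      _ = (2 * (L * ℓ) + 1) ^ 4 := by
        rw [Finset.sum_const, card_box, nsmul_eq_mul, mul_one, hℓ]; push_cast; ring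
      _ ≤ (3 * (L * ℓ)) ^ 4 := by
        gcongr
        nlinarith
      _ = _ := by ring
  have hsq : (ℓ ^ 2 * I) ^ 2 ≤ (∑ x ∈ box (L ^ (j + 1)), cov φ R L m2 (j + 1) x * Real.cos (dot k x)) ^ 2 := by
    gcongr
  have hnn : 0 ≤ ∑ x ∈ box (L ^ (j + 1)), cov φ R L m2 (j + 1) x ^ 2 := by positivity
  rw [div_le_iff₀ (by positivity)]
  have hfin := hsq.trans (hcs.trans (mul_le_mul_of_nonneg_left hcard hnn))
  have hℓ4 : 0 < ℓ ^ 4 := by positivity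
  refine le_of_mul_le_mul_right ?_ hℓ4
  calc I ^ 2 * ℓ ^ 4 = (ℓ ^ 2 * I) ^ 2 := by ring
    _ ≤ _ := hfin
    _ = _ := by ring

/-! ### Upper bounds on the covariances -/

lemma integral_torus_inv_le {b : ℝ} (hb : 0 < b) :
    ∫ k in torus, ∏ i, (1 + (b * k i) ^ 2)⁻¹ ≤ (Real.pi / b) ^ 4 := by
  have hint : MeasureTheory.Integrable fun u : ℝ => (1 + (b * u) ^ 2)⁻¹ :=
    integrable_inv_one_add_sq.comp_mul_left' hb.ne'
  have h1 : ∫ u in Set.Icc (-Real.pi) Real.pi, (1 + (b * u) ^ 2)⁻¹ ≤ Real.pi / b := by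
    calc _ ≤ ∫ u : ℝ, (1 + (b * u) ^ 2)⁻¹ :=
          MeasureTheory.setIntegral_le_integral hint (Filter.Eventually.of_forall fun u => by
            simp only [Pi.zero_apply]; positivity)
      _ = Real.pi / b := by
        rw [MeasureTheory.Measure.integral_comp_mul_left (fun u : ℝ => (1 + u ^ 2)⁻¹),
          integral_univ_inv_one_add_sq, abs_of_pos (inv_pos.2 hb), smul_eq_mul]
        field_simp
  rw [integral_torus_prod (fun _ u => (1 + (b * u) ^ 2)⁻¹), Finset.prod_const, Finset.card_univ,
    Fintype.card_fin]
  have : 0 ≤ ∫ u in Set.Icc (-Real.pi) Real.pi, (1 + (b * u) ^ 2)⁻¹ :=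
    MeasureTheory.integral_nonneg fun u => by simp only [Pi.zero_apply]; positivity
  gcongr

lemma integral_torus_one : ∫ _k in torus, (1 : ℝ) = (2 * Real.pi) ^ 4 := by
  simpa using integral_cos_dot 0

/-- The moments `(2π)⁻⁴ ∫ F_t λᵃ` of the symbol of `scaleKernel` scale like `t^{-2-2a}` and decay
rapidly above the mass scale. -/
lemma exists_moment_le {φ : 𝓢(ℝ, ℝ)} (hφ : IsProfile φ) {R : ℝ} (hR0 : 0 < R) (a s : ℕ) :
    ∃ K, 0 ≤ K ∧ ∀ t m2 : ℝ, 1 ≤ t → 0 ≤ m2 → 16 + m2 ≤ 4 * R →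
      ((2 * Real.pi) ^ 4)⁻¹ * ∫ k in torus, scaleSymbol φ R t m2 k * laplaceSymbol k ^ a
        ≤ K * (t ^ (2 + 2 * a))⁻¹ * ((1 + m2 * t ^ 2 / R) ^ s)⁻¹ := by
  obtain ⟨K, hK, hW⟩ := spectralFn_le φ (s + 4 + a)
  have hpi := Real.pi_pos
  set b : ℝ := √(4 / (Real.pi ^ 2 * R)) with hb
  have hb0 : 0 < b := Real.sqrt_pos.2 (by positivity)
  have hb2 : b ^ 2 = 4 / Real.pi ^ 2 / R := by
    rw [hb, Real.sq_sqrt (by positivity), div_div]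
  refine ⟨((2 * Real.pi) ^ 4)⁻¹ * (K * R ^ a / R * (Real.pi / b) ^ 4), by positivity,
    fun t m2 ht hm hR => ?_⟩
  have ht0 : 0 < t := by linarith
  set χ : ℝ := ((1 + m2 * t ^ 2 / R) ^ s)⁻¹ with hχ
  have hχ0 : 0 ≤ χ := by positivity
  have hpt : ∀ k ∈ torus, scaleSymbol φ R t m2 k * laplaceSymbol k ^ a
      ≤ K * R ^ a / R * (t ^ 2 / (t ^ 2) ^ a) * χ * ∏ i, (1 + (b * t * k i) ^ 2)⁻¹ := by
    intro k hk
    obtain ⟨h0, h4⟩ := energy_mem hm hR k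
    have hl := laplaceSymbol_nonneg k
    have hRE : R * ((laplaceSymbol k + m2) / R) = laplaceSymbol k + m2 := by field_simp
    have hWk := hW t _ ht h0 h4
    rw [scaleSymbol]
    set E := (laplaceSymbol k + m2) / R with hE
    set D := 1 + E * t ^ 2 with hD
    have hD0 : 0 < D := by positivity
    have h1 : laplaceSymbol k ^ a ≤ R ^ a * D ^ a / (t ^ 2) ^ a := by
      rw [le_div_iff₀ (by positivity), ← mul_pow, ← mul_pow]
      refine pow_le_pow_left₀ (by positivity) ?_ a
      have : laplaceSymbol k ≤ R * E := by linarith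
      nlinarith [mul_le_mul_of_nonneg_right this (sq_nonneg t)]
    have h2 : 1 + m2 * t ^ 2 / R ≤ D := by
      have : m2 * t ^ 2 / R ≤ E * t ^ 2 := by
        rw [hE, div_mul_eq_mul_div]
        gcongr
        linarith
      linarith
    have h3 : ∏ i, (1 + (b * t * k i) ^ 2) ≤ D ^ 4 := by
      have : ∀ i ∈ Finset.univ, 1 + (b * t * k i) ^ 2 ≤ D := fun i _ => by
        have h5 := mul_sq_le_laplaceSymbol hk
        have h6 : k i ^ 2 ≤ ∑ l, k l ^ 2 :=
          Finset.single_le_sum (f := fun l => k l ^ 2) (fun l _ => sq_nonneg _) (Finset.mem_univ i)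
        have h7 : (b * t * k i) ^ 2 ≤ E * t ^ 2 := by
          calc (b * t * k i) ^ 2 = (4 / Real.pi ^ 2 * k i ^ 2) / R * t ^ 2 := by
                rw [mul_pow, mul_pow, hb2]; ring
            _ ≤ _ := by
                rw [hE]
                gcongr
                have := mul_le_mul_of_nonneg_left h6 (by positivity : 0 ≤ 4 / Real.pi ^ 2)
                linarith
        linarith
      calc _ ≤ ∏ _i : Fin 4, D := Finset.prod_le_prod (fun i _ => by positivity) this
        _ = D ^ 4 := by simp
    calc t ^ 2 / R * spectralFn φ t E * laplaceSymbol k ^ a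
        ≤ t ^ 2 / R * (K * (D ^ (s + 4 + a))⁻¹) * (R ^ a * D ^ a / (t ^ 2) ^ a) := by
          have := hφ.spectralFn_nonneg t E
          gcongr
      _ = K * R ^ a / R * (t ^ 2 / (t ^ 2) ^ a) * ((D ^ s)⁻¹ * (D ^ 4)⁻¹) := by
          rw [pow_add, pow_add]
          field_simp
      _ ≤ K * R ^ a / R * (t ^ 2 / (t ^ 2) ^ a) * (χ * ∏ i, (1 + (b * t * k i) ^ 2)⁻¹) := by
          rw [Finset.prod_inv_distrib, hχ]
          gcongr
      _ = _ := by ring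
  have hcs := hφ.continuous_scaleSymbol hm hR ht0
  have hint : ∫ k in torus, scaleSymbol φ R t m2 k * laplaceSymbol k ^ a
      ≤ K * R ^ a / R * (t ^ 2 / (t ^ 2) ^ a) * χ * (Real.pi / (b * t)) ^ 4 := by
    have hc : Continuous fun k : Fin 4 → ℝ => ∏ i, (1 + (b * t * k i) ^ 2)⁻¹ := by
      refine continuous_finsetProd _ fun i _ => Continuous.inv₀ (by fun_prop) fun k => by positivity
    refine (MeasureTheory.setIntegral_mono_on (Continuous.integrableOn_torus (by fun_prop))
      (Continuous.integrableOn_torus (by fun_prop)) measurableSet_torus hpt).trans ?_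
    rw [MeasureTheory.integral_const_mul]
    exact mul_le_mul_of_nonneg_left (integral_torus_inv_le (by positivity)) (by positivity)
  calc _ ≤ ((2 * Real.pi) ^ 4)⁻¹ *
        (K * R ^ a / R * (t ^ 2 / (t ^ 2) ^ a) * χ * (Real.pi / (b * t)) ^ 4) := by gcongr
    _ = _ := by
      rw [← pow_mul, pow_add t 2]
      field_simp

/-- For all `t > 0` the moments are at most linear in `t` near `0`. -/
lemma exists_moment_le_of_pos {φ : 𝓢(ℝ, ℝ)} (hφ : IsProfile φ) {R : ℝ} (hR0 : 0 < R) (a : ℕ) :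
    ∃ K, 0 ≤ K ∧ ∀ t m2 : ℝ, 0 < t → 0 ≤ m2 → 16 + m2 ≤ 4 * R →
      ((2 * Real.pi) ^ 4)⁻¹ * ∫ k in torus, scaleSymbol φ R t m2 k * laplaceSymbol k ^ a
        ≤ K * t * (1 + t) := by
  obtain ⟨K, hK, hW⟩ := hφ.mul_spectralFn_le
  refine ⟨K * 16 ^ a / R, by positivity, fun t m2 ht hm hR => ?_⟩
  have hpt : ∀ k ∈ torus, scaleSymbol φ R t m2 k * laplaceSymbol k ^ a
      ≤ K * 16 ^ a / R * t * (1 + t) * 1 := by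
    intro k _
    obtain ⟨h0, h4⟩ := energy_mem hm hR k
    have hl := laplaceSymbol_nonneg k
    have hl' := laplaceSymbol_le k
    have h := hW t _ ht h0 h4
    have hn := hφ.spectralFn_nonneg t ((laplaceSymbol k + m2) / R)
    rw [scaleSymbol]
    calc _ = t / R * (t * spectralFn φ t ((laplaceSymbol k + m2) / R)) * laplaceSymbol k ^ a := by ring
      _ ≤ t / R * (K * (1 + t)) * 16 ^ a := by gcongr
      _ = _ := by ring
  have hcs := hφ.continuous_scaleSymbol hm hR ht
  have hint := MeasureTheory.setIntegral_mono_on (Continuous.integrableOn_torus (by fun_prop))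
    (Continuous.integrableOn_torus (by fun_prop)) measurableSet_torus hpt
  rw [MeasureTheory.integral_const_mul, integral_torus_one] at hint
  calc _ ≤ ((2 * Real.pi) ^ 4)⁻¹ * (K * 16 ^ a / R * t * (1 + t) * (2 * Real.pi) ^ 4) := by gcongr
    _ = _ := by
      have := Real.pi_pos
      field_simp

/-- The decay factor `(1 + m² L^{2j} / (4R))^{-s}` beyond the mass scale. -/
def massDecay (R : ℝ) (L s : ℕ) (m2 : ℝ) (j : ℕ) : ℝ :=
  ((1 + m2 * (L : ℝ) ^ (2 * j) / (4 * R)) ^ s)⁻¹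

lemma massDecay_pos {R m2 : ℝ} (hR0 : 0 < R) (hm : 0 ≤ m2) (L s j : ℕ) : 0 < massDecay R L s m2 j := by
  unfold massDecay; positivity

lemma massDecay_le_one {R m2 : ℝ} (hR0 : 0 < R) (hm : 0 ≤ m2) (L s j : ℕ) :
    massDecay R L s m2 j ≤ 1 := by
  unfold massDecay
  refine inv_le_one_of_one_le₀ (one_le_pow₀ ?_)
  have : 0 ≤ m2 * (L : ℝ) ^ (2 * j) / (4 * R) := by positivity
  linarith

/-- A combination of covariances whose multiplier is of order `λᵃ` is of order `L^{-(2+2a)j}`. -/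
lemma exists_abs_sum_mul_cov_le {φ : 𝓢(ℝ, ℝ)} (hφ : IsProfile φ) {R mbar2 : ℝ} (hmbar : 0 ≤ mbar2)
    (hR : 16 + mbar2 ≤ 4 * R) {L : ℕ} (hL : 2 ≤ L) (a s : ℕ) :
    ∃ K, 0 ≤ K ∧ ∀ m2 ∈ Set.Icc 0 mbar2, ∀ (j n : ℕ) (v : Fin n → ℝ) (y : Fin n → Lattice) (B : ℝ),
      0 ≤ B → (∀ k ∈ torus, |∑ i, v i * Real.cos (dot k (y i))| ≤ B * laplaceSymbol k ^ a) →
      |∑ i, v i * cov φ R L m2 (j + 1) (y i)|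
        ≤ K * B * ((L : ℝ) ^ ((2 + 2 * a) * j))⁻¹ * massDecay R L s m2 j := by
  have hR0 : 0 < R := by linarith
  have hL1 : 1 ≤ L := by lia
  have hL2 : (2 : ℝ) ≤ L := by exact_mod_cast hL
  have hpi := Real.pi_pos
  obtain ⟨K₁, hK₁, h₁⟩ := exists_moment_le hφ hR0 a s
  obtain ⟨K₀, hK₀, h₀⟩ := exists_moment_le_of_pos hφ hR0 a
  have hχ₀ : 0 < massDecay R L s mbar2 0 := massDecay_pos hR0 hmbar L s 0
  refine ⟨2 ^ (3 + 2 * a) * L * K₁ + K₀ * (1 + L) * L / massDecay R L s mbar2 0, by positivity, ?_⟩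
  intro m2 hm j n v y B hB hv
  have hR' : 16 + m2 ≤ 4 * R := by linarith [hm.2]
  have hχ := massDecay_pos hR0 hm.1 L s j
  have hle := scaleStart_le hL1 (j + 1)
  have hst := scaleStart_nonneg L (j + 1)
  -- bound at a fixed scale `t`
  have hscale : ∀ t, 0 < t → |∑ i, v i * (scaleKernel φ R t m2 (y i) / t)|
      ≤ B * (((2 * Real.pi) ^ 4)⁻¹ * ∫ k in torus, scaleSymbol φ R t m2 k * laplaceSymbol k ^ a) / t := by
    intro t ht
    have hcs := hφ.continuous_scaleSymbol hm.1 hR' ht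
    have e := sum_mul_latticeCoeff hcs Finset.univ v y
    simp only [scaleKernel_eq_latticeCoeff, ← mul_div_assoc, ← Finset.sum_div, e]
    rw [abs_div, abs_of_pos ht, abs_mul, abs_of_pos (by positivity : 0 < ((2 * Real.pi) ^ 4)⁻¹),
      mul_left_comm]
    gcongr
    refine MeasureTheory.abs_integral_le_integral_abs.trans ?_
    rw [← MeasureTheory.integral_const_mul]
    refine MeasureTheory.setIntegral_mono_on (Continuous.integrableOn_torus (by fun_prop))
      (Continuous.integrableOn_torus (by fun_prop)) measurableSet_torus fun k hk => ?_
    have hn := hφ.scaleSymbol_nonneg hR' hm.1 t k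
    rw [abs_mul, abs_of_nonneg hn, mul_left_comm]
    exact mul_le_mul_of_nonneg_left (hv k hk) hn
  rw [hφ.sum_mul_cov hm.1 hR' hL1 (j + 1) Finset.univ v y]
  have hlen : |(L : ℝ) ^ (j + 1) / 2 - scaleStart L (j + 1)| ≤ (L : ℝ) ^ (j + 1) := by
    rw [abs_of_nonneg (by linarith)]
    have : 0 ≤ (L : ℝ) ^ (j + 1) := by positivity
    linarith
  have hKadd : 2 ^ (3 + 2 * a) * L * K₁ ≤ 2 ^ (3 + 2 * a) * L * K₁ + K₀ * (1 + L) * L / massDecay R L s mbar2 0 :=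
    le_add_of_nonneg_right (by positivity)
  have hKadd' : K₀ * (1 + L) * L / massDecay R L s mbar2 0 ≤
      2 ^ (3 + 2 * a) * L * K₁ + K₀ * (1 + L) * L / massDecay R L s mbar2 0 :=
    le_add_of_nonneg_left (by positivity)
  rcases Nat.eq_zero_or_pos j with rfl | hj
  · -- the scales near `t = 0` belong to the first covariance
    have hb : ∀ t ∈ Set.uIoc (scaleStart L (0 + 1)) ((L : ℝ) ^ (0 + 1) / 2),
        ‖∑ i, v i * (scaleKernel φ R t m2 (y i) / t)‖ ≤ B * (K₀ * (1 + L)) := by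
      intro t ht
      rw [Set.uIoc_of_le hle] at ht
      have ht0 : 0 < t := hst.trans_lt ht.1
      have htL : t ≤ L := by
        have := ht.2
        simp only [zero_add, pow_one] at this
        linarith
      refine (hscale t ht0).trans ?_
      rw [div_le_iff₀ ht0]
      calc _ ≤ B * (K₀ * t * (1 + t)) := mul_le_mul_of_nonneg_left (h₀ t m2 ht0 hm.1 hR') hB
        _ ≤ B * (K₀ * t * (1 + L)) := by gcongr
        _ = _ := by ring
    have h := intervalIntegral.norm_integral_le_of_norm_le_const hb
    rw [Real.norm_eq_abs] at h
    refine h.trans ((mul_le_mul_of_nonneg_left hlen (by positivity)).trans ?_)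
    have hmono : massDecay R L s mbar2 0 ≤ massDecay R L s m2 0 := by
      have := hm.1
      have := hm.2
      unfold massDecay
      gcongr
    calc B * (K₀ * (1 + L)) * L ^ (0 + 1)
        = K₀ * (1 + L) * L / massDecay R L s mbar2 0 * B * massDecay R L s mbar2 0 := by
          field_simp
          ring
      _ ≤ (2 ^ (3 + 2 * a) * L * K₁ + K₀ * (1 + L) * L / massDecay R L s mbar2 0) * B * massDecay R L s m2 0 := by
          gcongr
      _ = _ := by simp
  · set ℓ : ℝ := (L : ℝ) ^ j with hℓ
    have hℓ2 : 2 ≤ ℓ := by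
      calc (2 : ℝ) ≤ L := hL2
        _ = (L : ℝ) ^ 1 := (pow_one _).symm
        _ ≤ ℓ := pow_le_pow_right₀ (by linarith) hj
    have hstart : scaleStart L (j + 1) = ℓ / 2 := by
      rw [scaleStart, if_neg (by lia)]; simp [hℓ]
    have hb : ∀ t ∈ Set.uIoc (scaleStart L (j + 1)) ((L : ℝ) ^ (j + 1) / 2),
        ‖∑ i, v i * (scaleKernel φ R t m2 (y i) / t)‖
          ≤ B * (K₁ * ((ℓ / 2) ^ (3 + 2 * a))⁻¹ * massDecay R L s m2 j) := by
      intro t ht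
      rw [Set.uIoc_of_le hle, hstart] at ht
      have ht1 : ℓ / 2 ≤ t := ht.1.le
      have ht0 : 0 < t := by linarith
      have hm0 := hm.1
      refine (hscale t ht0).trans ?_
      calc _ ≤ B * (K₁ * (t ^ (2 + 2 * a))⁻¹ * ((1 + m2 * t ^ 2 / R) ^ s)⁻¹) / t := 
            div_le_div_of_nonneg_right
              (mul_le_mul_of_nonneg_left (h₁ t m2 (by linarith) hm.1 hR') hB) ht0.le
        _ = B * (K₁ * (t ^ (3 + 2 * a))⁻¹ * ((1 + m2 * t ^ 2 / R) ^ s)⁻¹) := by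
            rw [show 3 + 2 * a = 2 + 2 * a + 1 by ring, pow_succ t (2 + 2 * a), mul_inv]
            ring
        _ ≤ B * (K₁ * ((ℓ / 2) ^ (3 + 2 * a))⁻¹ * ((1 + m2 * (ℓ / 2) ^ 2 / R) ^ s)⁻¹) := by
            gcongr
        _ = _ := by
            rw [massDecay, mul_comm 2 j, pow_mul, ← hℓ]
            congr 5
            ring
    have h := intervalIntegral.norm_integral_le_of_norm_le_const hb
    rw [Real.norm_eq_abs] at h
    refine h.trans ((mul_le_mul_of_nonneg_left hlen (by positivity)).trans ?_)
    calc B * (K₁ * ((ℓ / 2) ^ (3 + 2 * a))⁻¹ * massDecay R L s m2 j) * L ^ (j + 1)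
        = 2 ^ (3 + 2 * a) * L * K₁ * B * (ℓ ^ (2 + 2 * a))⁻¹ * massDecay R L s m2 j := by
          rw [pow_succ, ← hℓ, div_pow, show 3 + 2 * a = 2 + 2 * a + 1 by ring,
            pow_succ ℓ (2 + 2 * a)]
          field_simp
      _ ≤ _ := by
          rw [mul_comm _ j, pow_mul, ← hℓ]
          gcongr

/-- The estimates on a finite-range covariance decomposition `C` that the bounds on the coefficients
rest on, with a common decay factor `χ`. -/
structure CovBounds (L : ℕ) (K : ℝ) (χ : ℕ → ℝ) (C : ℕ → Lattice → ℝ) : Prop where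
  range : ∀ j x, x ∉ box (L ^ j) → C j x = 0
  value : ∀ j x, |C (j + 1) x| ≤ K * ((L : ℝ) ^ (2 * j))⁻¹ * χ j
  increment : ∀ j x, |C (j + 1) x - C (j + 1) 0|
    ≤ K * (∑ i, (x i : ℝ) ^ 2) * ((L : ℝ) ^ (4 * j))⁻¹ * χ j
  laplacian : ∀ j x, |lap (C (j + 1)) x| ≤ K * ((L : ℝ) ^ (4 * j))⁻¹ * χ j

lemma exists_covBounds {φ : 𝓢(ℝ, ℝ)} (hφ : IsProfile φ) {R mbar2 : ℝ} (hmbar : 0 ≤ mbar2)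
    (hR : 16 + mbar2 ≤ 4 * R) {L : ℕ} (hL : 2 ≤ L) (s : ℕ) :
    ∃ K, 0 ≤ K ∧ ∀ m2 ∈ Set.Icc 0 mbar2, CovBounds L K (massDecay R L s m2) (cov φ R L m2) := by
  have hR0 : 0 < R := by linarith
  obtain ⟨K₀, hK₀, h₀⟩ := exists_abs_sum_mul_cov_le hφ hmbar hR hL 0 s
  obtain ⟨K₁, hK₁, h₁⟩ := exists_abs_sum_mul_cov_le hφ hmbar hR hL 1 s
  have hpi2 : Real.pi ^ 2 / 8 ≤ 2 := by nlinarith [Real.pi_lt_four, Real.pi_pos]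
  refine ⟨K₀ + 4 * K₁, by positivity, fun m2 hm => ⟨?_, ?_, ?_, ?_⟩⟩
  · intro j x hx
    exact hφ.cov_eq_zero hm.1 (by linarith [hm.2]) (by lia) hx
  · intro j x
    have hχ := massDecay_pos hR0 hm.1 L s j
    have h := h₀ m2 hm j 1 (fun _ => 1) (fun _ => x) 1 zero_le_one
      fun k _ => by simpa using Real.abs_cos_le_one _
    simp only [Finset.univ_unique, Finset.sum_singleton, one_mul, mul_zero, add_zero, mul_one] at h
    refine h.trans ?_
    gcongr
    linarith
  · intro j x
    have hχ := massDecay_pos hR0 hm.1 L s j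
    have hx : 0 ≤ ∑ i, (x i : ℝ) ^ 2 := by positivity
    have h := h₁ m2 hm j 2 ![1, -1] ![x, 0] (2 * ∑ i, (x i : ℝ) ^ 2) (by positivity)
      fun k hk => by
        have h1 := one_sub_cos_dot_le hk x
        have h2 := Real.cos_le_one (dot k x)
        have h3 := laplaceSymbol_nonneg k
        have h4 : Real.pi ^ 2 / 8 * laplaceSymbol k * ∑ i, (x i : ℝ) ^ 2
            ≤ 2 * laplaceSymbol k * ∑ i, (x i : ℝ) ^ 2 := by gcongr
        simp only [Fin.sum_univ_two, Matrix.cons_val_zero, Matrix.cons_val_one, dot_zero, Real.cos_zero]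
        rw [abs_le]
        constructor <;> nlinarith
    simp only [Fin.sum_univ_two, Matrix.cons_val_zero, Matrix.cons_val_one, one_mul, neg_mul,
      ← sub_eq_add_neg] at h
    refine h.trans ?_
    rw [show K₁ * (2 * ∑ i, (x i : ℝ) ^ 2) = 2 * K₁ * ∑ i, (x i : ℝ) ^ 2 by ring]
    gcongr
    linarith
  · intro j x
    have hχ := massDecay_pos hR0 hm.1 L s j
    have hi : ∀ i ∈ Finset.univ, |cov φ R L m2 (j + 1) (x + unit i) + cov φ R L m2 (j + 1) (x - unit i)
        - 2 * cov φ R L m2 (j + 1) x| ≤ K₁ * ((L : ℝ) ^ (4 * j))⁻¹ * massDecay R L s m2 j := by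
      intro i _
      have h := h₁ m2 hm j 3 ![1, 1, -2] ![x + unit i, x - unit i, x] 1 zero_le_one
        fun k _ => by
          simp only [Fin.sum_univ_three, Matrix.cons_val_zero, Matrix.cons_val_one, Matrix.cons_val,
            dot_add, dot_sub, dot_unit, Real.cos_add, Real.cos_sub]
          have e : 1 * (Real.cos (dot k x) * Real.cos (k i) - Real.sin (dot k x) * Real.sin (k i)) +
              1 * (Real.cos (dot k x) * Real.cos (k i) + Real.sin (dot k x) * Real.sin (k i)) +
              -2 * Real.cos (dot k x) = -(2 * (1 - Real.cos (k i)) * Real.cos (dot k x)) := by ring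
          have h1 : 0 ≤ 2 * (1 - Real.cos (k i)) := by linarith [Real.cos_le_one (k i)]
          rw [e, abs_neg, abs_mul, abs_of_nonneg h1, one_mul, pow_one]
          refine (mul_le_of_le_one_right h1 (Real.abs_cos_le_one _)).trans ?_
          exact Finset.single_le_sum (f := fun l => 2 * (1 - Real.cos (k l)))
            (fun l _ => by linarith [Real.cos_le_one (k l)]) (Finset.mem_univ i)
      simp only [Fin.sum_univ_three, Matrix.cons_val_zero, Matrix.cons_val_one, Matrix.cons_val,
        one_mul, mul_one, neg_mul, ← sub_eq_add_neg] at h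
      exact h
    refine (Finset.abs_sum_le_sum_abs _ _).trans ((Finset.sum_le_sum hi).trans ?_)
    rw [Finset.sum_const, Finset.card_univ, Fintype.card_fin, nsmul_eq_mul, ← mul_assoc, ← mul_assoc]
    gcongr
    push_cast
    linarith

/-! ### Bounds on the coefficients of the flow -/

/-- The squared Euclidean norm of a lattice point. -/
def normSq (x : Lattice) : ℝ := ∑ i, (x i : ℝ) ^ 2

lemma normSq_nonneg (x : Lattice) : 0 ≤ normSq x := Finset.sum_nonneg fun _ _ => sq_nonneg _

lemma sq_le_normSq (x : Lattice) (i : Fin 4) : (x i : ℝ) ^ 2 ≤ normSq x :=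
  Finset.single_le_sum (f := fun i => (x i : ℝ) ^ 2) (fun _ _ => sq_nonneg _) (Finset.mem_univ i)

lemma normSq_le_of_mem_box {n : ℕ} {x : Lattice} (hx : x ∈ box n) : normSq x ≤ 4 * (n : ℝ) ^ 2 := by
  have h : ∀ i ∈ Finset.univ, (x i : ℝ) ^ 2 ≤ (n : ℝ) ^ 2 := fun i _ => by
    rw [sq_le_sq, Nat.abs_cast]
    exact_mod_cast mem_box.1 hx i
  simpa [normSq] using Finset.sum_le_sum h

lemma w_zero (C : ℕ → Lattice → ℝ) (x : Lattice) : w C 0 x = 0 := by simp [w]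

lemma w_succ (C : ℕ → Lattice → ℝ) (j : ℕ) (x : Lattice) :
    w C (j + 1) x = w C j x + C (j + 1) x := by
  simp [w, Finset.sum_Icc_succ_top]

lemma lap_add (f g : Lattice → ℝ) (x : Lattice) :
    lap (fun y => f y + g y) x = lap f x + lap g x := by
  simp only [lap, ← Finset.sum_add_distrib]
  exact Finset.sum_congr rfl fun i _ => by ring

lemma tsum_eq_sum_box {f : Lattice → ℝ} {n : ℕ} (hf : ∀ x, x ∉ box n → f x = 0) :
    ∑' x, f x = ∑ x ∈ box n, f x := tsum_eq_sum fun x hx => hf x hx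

/-- The lattice Laplacian is symmetric. -/
lemma tsum_mul_lap_comm {f g : Lattice → ℝ} {n : ℕ} (hf : ∀ x, x ∉ box n → f x = 0)
    (hg : ∀ x, x ∉ box n → g x = 0) : ∑' x, f x * lap g x = ∑' x, g x * lap f x := by
  have key : ∀ {f g : Lattice → ℝ}, (∀ x, x ∉ box n → f x = 0) → ∑' x, f x * lap g x
      = ∑ i, ((∑' x, f x * g (x + unit i)) + (∑' x, f x * g (x - unit i)) - 2 * ∑' x, f x * g x) := by
    intro f g hf
    have hs : ∀ h : Lattice → ℝ, Summable fun x => f x * h x := fun h =>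
      summable_of_ne_finset_zero (s := box n) fun x hx => by rw [hf x hx, zero_mul]
    have e : ∀ x, f x * lap g x
        = ∑ i, (f x * g (x + unit i) + f x * g (x - unit i) - 2 * (f x * g x)) := by
      intro x
      rw [lap, Finset.mul_sum]
      exact Finset.sum_congr rfl fun i _ => by ring
    simp_rw [e]
    rw [Summable.tsum_finsetSum fun i _ => ((hs _).add (hs _)).sub ((hs _).mul_left 2)]
    refine Finset.sum_congr rfl fun i _ => ?_
    rw [((hs _).add (hs _)).tsum_sub ((hs _).mul_left 2), (hs _).tsum_add (hs _), tsum_mul_left]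
  rw [key hf, key hg]
  refine Finset.sum_congr rfl fun i _ => ?_
  have h1 : ∑' x, f x * g (x + unit i) = ∑' x, g x * f (x - unit i) := by
    rw [← (Equiv.addRight (unit i)).tsum_eq fun x => g x * f (x - unit i)]
    exact tsum_congr fun x => by simp [mul_comm]
  have h2 : ∑' x, f x * g (x - unit i) = ∑' x, g x * f (x + unit i) := by
    rw [← (Equiv.addRight (unit i)).tsum_eq fun x => f x * g (x - unit i)]
    exact tsum_congr fun x => by simp [mul_comm]
  have h3 : ∑' x, f x * g x = ∑' x, g x * f x := tsum_congr fun x => mul_comm _ _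
  rw [h1, h2, h3]
  ring

section

variable {L : ℕ} {K : ℝ} {χ : ℕ → ℝ} {C : ℕ → Lattice → ℝ}

lemma w_eq_zero (hL : 1 ≤ L) (hC : ∀ j x, x ∉ box (L ^ j) → C j x = 0) {i j : ℕ} (hij : i ≤ j)
    {x : Lattice} (hx : x ∉ box (L ^ j)) : w C i x = 0 :=
  Finset.sum_eq_zero fun l hl => hC l x fun h =>
    hx (box_mono (Nat.pow_le_pow_right hL ((Finset.mem_Icc.1 hl).2.trans hij)) h)

lemma beta_eq (hL : 1 ≤ L) (hC : ∀ j x, x ∉ box (L ^ j) → C j x = 0) (j : ℕ) :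
    beta C j = 8 * ∑ x ∈ box (L ^ (j + 1)), (2 * (w C j x * C (j + 1) x) + C (j + 1) x ^ 2) := by
  have h0 : ∀ x, x ∉ box (L ^ (j + 1)) → w C (j + 1) x ^ 2 = 0 := fun x hx => by
    rw [w_eq_zero hL hC le_rfl hx]; norm_num
  have h1 : ∀ x, x ∉ box (L ^ (j + 1)) → w C j x ^ 2 = 0 := fun x hx => by
    rw [w_eq_zero hL hC j.le_succ hx]; norm_num
  rw [beta, delta, powSum, powSum, tsum_eq_sum_box h0, tsum_eq_sum_box h1, ← Finset.sum_sub_distrib]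
  congr 1
  exact Finset.sum_congr rfl fun x _ => by rw [w_succ]; ring

lemma theta_eq (hL : 1 ≤ L) (hC : ∀ j x, x ∉ box (L ^ j) → C j x = 0) (j : ℕ) :
    theta C j = 2 * ∑ x ∈ box (L ^ (j + 1)), (x 0 : ℝ) ^ 2 * C (j + 1) x *
      (w C (j + 1) x ^ 2 + w C (j + 1) x * w C j x + w C j x ^ 2) := by
  have h0 : ∀ x, x ∉ box (L ^ (j + 1)) → (x 0 : ℝ) ^ 2 * w C (j + 1) x ^ 3 = 0 := fun x hx => by
    rw [w_eq_zero hL hC le_rfl hx]; ring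
  have h1 : ∀ x, x ∉ box (L ^ (j + 1)) → (x 0 : ℝ) ^ 2 * w C j x ^ 3 = 0 := fun x hx => by
    rw [w_eq_zero hL hC j.le_succ hx]; ring
  rw [theta, delta, secondMoment, secondMoment, tsum_eq_sum_box h0, tsum_eq_sum_box h1,
    ← Finset.sum_sub_distrib]
  congr 1
  exact Finset.sum_congr rfl fun x _ => by rw [w_succ]; ring

lemma xiPrime_eq (hL : 1 ≤ L) (hC : ∀ j x, x ∉ box (L ^ j) → C j x = 0) (j : ℕ) :
    xiPrime C j = 4 * (∑ x ∈ box (L ^ (j + 1)), (3 * w C j x ^ 2 * (C (j + 1) x - C (j + 1) 0)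
      + (3 * w C j x + C (j + 1) x) * C (j + 1) x ^ 2)) + 1 / 4 * beta C j * etaPrime C j := by
  have h0 : ∀ x, x ∉ box (L ^ (j + 1)) → w C (j + 1) x ^ 3 = 0 := fun x hx => by
    rw [w_eq_zero hL hC le_rfl hx]; norm_num
  have h1 : ∀ n, n ≠ 0 → ∀ x, x ∉ box (L ^ (j + 1)) → w C j x ^ n = 0 := fun n hn x hx => by
    rw [w_eq_zero hL hC j.le_succ hx, zero_pow hn]
  rw [xiPrime, delta, powSum, powSum, powSum, tsum_eq_sum_box h0,
    tsum_eq_sum_box (h1 3 (by norm_num)), tsum_eq_sum_box (h1 2 (by norm_num)),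
    ← Finset.sum_sub_distrib, mul_assoc, Finset.sum_mul, Finset.mul_sum, ← Finset.sum_sub_distrib]
  congr 2
  exact Finset.sum_congr rfl fun x _ => by rw [w_succ]; ring

lemma piPrime_eq (hL : 1 ≤ L) (hC : ∀ j x, x ∉ box (L ^ j) → C j x = 0) (j : ℕ) :
    piPrime C j = 2 * ∑ x ∈ box (L ^ (j + 1)), (2 * w C j x + C (j + 1) x) * lap (C (j + 1)) x := by
  have hw1 : ∀ x, x ∉ box (L ^ (j + 1)) → w C j x = 0 := fun x => w_eq_zero hL hC j.le_succ
  have hc : ∀ x, x ∉ box (L ^ (j + 1)) → C (j + 1) x = 0 := hC (j + 1)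
  have hs : ∀ {f : Lattice → ℝ} (h : Lattice → ℝ), (∀ x, x ∉ box (L ^ (j + 1)) → f x = 0) →
      Summable fun x => f x * h x := fun h hf =>
    summable_of_ne_finset_zero (s := box (L ^ (j + 1))) fun x hx => by rw [hf x hx, zero_mul]
  have hsucc : w C (j + 1) = fun x => w C j x + C (j + 1) x := funext (w_succ C j)
  have e : ∑' x, w C (j + 1) x * lap (w C (j + 1)) x = (∑' x, w C j x * lap (w C j) x)
      + (∑' x, w C j x * lap (C (j + 1)) x) + (∑' x, C (j + 1) x * lap (w C j) x)
      + ∑' x, C (j + 1) x * lap (C (j + 1)) x := by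
    rw [← (hs _ hw1).tsum_add (hs _ hw1), ← ((hs _ hw1).add (hs _ hw1)).tsum_add (hs _ hc),
      ← (((hs _ hw1).add (hs _ hw1)).add (hs _ hc)).tsum_add (hs _ hc)]
    refine tsum_congr fun x => ?_
    rw [hsucc, lap_add]
    ring
  rw [tsum_mul_lap_comm hc hw1] at e
  rw [piPrime, delta, powSum, powSum]
  simp only [pow_one]
  rw [e, tsum_eq_sum_box fun x hx => by rw [hw1 x hx, zero_mul],
    tsum_eq_sum_box fun x hx => by rw [hw1 x hx, zero_mul],
    tsum_eq_sum_box fun x hx => by rw [hc x hx, zero_mul]]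
  have h2 : ∑ x ∈ box (L ^ (j + 1)), (2 * w C j x + C (j + 1) x) * lap (C (j + 1)) x
      = 2 * (∑ x ∈ box (L ^ (j + 1)), w C j x * lap (C (j + 1)) x)
        + ∑ x ∈ box (L ^ (j + 1)), C (j + 1) x * lap (C (j + 1)) x := by
    rw [Finset.mul_sum, ← Finset.sum_add_distrib]
    exact Finset.sum_congr rfl fun x _ => by ring
  rw [h2]
  ring

namespace CovBounds

variable (hL : 2 ≤ L) (hK : 0 ≤ K) (hχ0 : ∀ j, 0 ≤ χ j) (hχ1 : ∀ j, χ j ≤ 1)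
  (h : CovBounds L K χ C)

include hL hK hχ0 h

lemma sum_abs_le (j : ℕ) :
    ∑ x ∈ box (L ^ (j + 1)), |C (j + 1) x| ≤ 81 * L ^ 4 * K * (L : ℝ) ^ (2 * j) * χ j := by
  have hL2 : (2 : ℝ) ≤ L := by exact_mod_cast hL
  have hℓ : (1 : ℝ) ≤ (L : ℝ) ^ (j + 1) := one_le_pow₀ (by linarith)
  have hχj := hχ0 j
  calc _ ≤ ∑ _x ∈ box (L ^ (j + 1)), K * ((L : ℝ) ^ (2 * j))⁻¹ * χ j :=
        Finset.sum_le_sum fun x _ => h.value j x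
    _ = (2 * (L : ℝ) ^ (j + 1) + 1) ^ 4 * (K * ((L : ℝ) ^ (2 * j))⁻¹ * χ j) := by
        rw [Finset.sum_const, card_box, nsmul_eq_mul]; push_cast; ring
    _ ≤ (3 * (L : ℝ) ^ (j + 1)) ^ 4 * (K * ((L : ℝ) ^ (2 * j))⁻¹ * χ j) := by
        gcongr
        linarith
    _ = _ := by
        rw [pow_succ, mul_comm 2 j, pow_mul]
        field_simp
        ring

include hχ1

/-- The sum of the geometric series of the bounds on `C_1, …, C_j`. -/
lemma sum_abs_w_le {j n : ℕ} (hn : L ^ j ≤ n) :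
    ∑ x ∈ box n, |w C j x| ≤ 81 * L ^ 4 * K * (L : ℝ) ^ (2 * j) := by
  have hL2 : (2 : ℝ) ≤ L := by exact_mod_cast hL
  have hL4 : (4 : ℝ) ≤ (L : ℝ) ^ 2 := by nlinarith
  have hbox : ∑ x ∈ box n, |w C j x| = ∑ x ∈ box (L ^ j), |w C j x| := by
    refine (Finset.sum_subset (box_mono hn) fun x _ hx => ?_).symm
    rw [w_eq_zero (by lia) h.range le_rfl hx, abs_zero]
  rw [hbox]
  clear hbox hn n
  induction j with
  | zero => simp [w_zero]; positivity
  | succ j ih =>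
    have hbox : ∑ x ∈ box (L ^ (j + 1)), |w C j x| = ∑ x ∈ box (L ^ j), |w C j x| := by
      refine (Finset.sum_subset (box_mono (Nat.pow_le_pow_right (by lia) j.le_succ))
        fun x _ hx => ?_).symm
      rw [w_eq_zero (by lia) h.range le_rfl hx, abs_zero]
    have hc := h.sum_abs_le hL hK hχ0 j
    have hc' : 81 * L ^ 4 * K * (L : ℝ) ^ (2 * j) * χ j ≤ 81 * L ^ 4 * K * (L : ℝ) ^ (2 * j) :=
      mul_le_of_le_one_right (by positivity) (hχ1 j)
    calc _ ≤ ∑ x ∈ box (L ^ (j + 1)), (|w C j x| + |C (j + 1) x|) :=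
          Finset.sum_le_sum fun x _ => by rw [w_succ]; exact abs_add_le _ _
      _ ≤ 2 * (81 * L ^ 4 * K * (L : ℝ) ^ (2 * j)) := by
          rw [Finset.sum_add_distrib, hbox]; linarith
      _ ≤ (L : ℝ) ^ 2 * (81 * L ^ 4 * K * (L : ℝ) ^ (2 * j)) := by gcongr; linarith
      _ = _ := by rw [show 2 * (j + 1) = 2 * j + 2 by ring, pow_add]; ring

omit hχ0 in
/-- `w_j` decays like `|x|⁻²`: the covariances with `L^i < |x|` vanish at `x`, and the others form
a convergent geometric series. The maximum in the induction hypothesis vanishes until the scale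
reaches `|x|`. -/
lemma normSq_mul_abs_w_le (j : ℕ) (x : Lattice) : normSq x * |w C j x| ≤ 8 * L ^ 2 * K := by
  have hL2 : (2 : ℝ) ≤ L := by exact_mod_cast hL
  have hL4 : (4 : ℝ) ≤ (L : ℝ) ^ 2 := by nlinarith
  have hr := normSq_nonneg x
  set A : ℝ := 4 * L ^ 2 with hA
  have key : ∀ j, normSq x * |w C j x| ≤ K * max 0 (2 * A - 2 * (normSq x / (L : ℝ) ^ (2 * j))) := by
    intro j
    induction j with
    | zero => rw [w_zero, abs_zero, mul_zero]; positivity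
    | succ j ih =>
      have hℓ : 0 < (L : ℝ) ^ (2 * j) := by positivity
      have hpow : (L : ℝ) ^ (2 * (j + 1)) = (L : ℝ) ^ (2 * j) * L ^ 2 := by
        rw [show 2 * (j + 1) = 2 * j + 2 by ring, pow_add]
      have hρ0 : 0 ≤ normSq x / (L : ℝ) ^ (2 * j) := by positivity
      have hρ : normSq x / (L : ℝ) ^ (2 * (j + 1)) ≤ normSq x / (L : ℝ) ^ (2 * j) / 4 := by
        rw [hpow, ← div_div]
        gcongr
      by_cases hx : x ∈ box (L ^ (j + 1))
      · have hrA : normSq x / (L : ℝ) ^ (2 * j) ≤ A := by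
          rw [div_le_iff₀ hℓ]
          have := normSq_le_of_mem_box hx
          push_cast at this
          rw [← pow_mul, mul_comm (j + 1) 2, hpow] at this
          rw [hA]
          linarith
        rw [max_eq_right (by linarith)] at ih
        refine le_trans ?_ (mul_le_mul_of_nonneg_left (le_max_right _ _) hK)
        have hv : normSq x * |C (j + 1) x| ≤ K * (normSq x / (L : ℝ) ^ (2 * j)) := by
          calc _ ≤ normSq x * (K * ((L : ℝ) ^ (2 * j))⁻¹ * χ j) :=
                mul_le_mul_of_nonneg_left (h.value j x) hr
            _ ≤ normSq x * (K * ((L : ℝ) ^ (2 * j))⁻¹ * 1) := by gcongr; exact hχ1 j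
            _ = _ := by ring
        have habs : |w C (j + 1) x| ≤ |w C j x| + |C (j + 1) x| := by
          rw [w_succ]; exact abs_add_le _ _
        have h1 := mul_le_mul_of_nonneg_left habs hr
        have h2 : K * (2 * A - 2 * (normSq x / (L : ℝ) ^ (2 * j))) + K * (normSq x / (L : ℝ) ^ (2 * j))
            ≤ K * (2 * A - 2 * (normSq x / (L : ℝ) ^ (2 * (j + 1)))) := by
          rw [← mul_add]
          gcongr
          linarith
        linarith
      · rw [w_eq_zero (by lia) h.range le_rfl hx, abs_zero, mul_zero]
        positivity
  refine (key j).trans ?_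
  rw [show 8 * (L : ℝ) ^ 2 * K = K * (2 * A) by rw [hA]; ring]
  gcongr
  refine max_le (by positivity) ?_
  have : 0 ≤ normSq x / (L : ℝ) ^ (2 * j) := by positivity
  linarith


lemma abs_beta_le (j : ℕ) : |beta C j| ≤ 24 * (81 * L ^ 4 * K) * K * χ j := by
  have hL0 : 0 < L := by lia
  rw [beta_eq (by lia) h.range]
  set A : ℝ := 81 * L ^ 4 * K with hA
  set S : ℝ := (L : ℝ) ^ (2 * j) with hS
  have hS0 : 0 < S := by positivity
  have hχj := hχ0 j
  have hw := h.sum_abs_w_le hL hK hχ0 hχ1 (Nat.pow_le_pow_right hL0 j.le_succ)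
  have hc : ∑ x ∈ box (L ^ (j + 1)), |C (j + 1) x| ≤ A * S :=
    (h.sum_abs_le hL hK hχ0 j).trans (mul_le_of_le_one_right (by positivity) (hχ1 j))
  have hterm : ∀ x ∈ box (L ^ (j + 1)), |2 * (w C j x * C (j + 1) x) + C (j + 1) x ^ 2|
      ≤ (2 * |w C j x| + |C (j + 1) x|) * (K * S⁻¹ * χ j) := by
    intro x _
    rw [show 2 * (w C j x * C (j + 1) x) + C (j + 1) x ^ 2
      = (2 * w C j x + C (j + 1) x) * C (j + 1) x by ring, abs_mul]
    refine mul_le_mul ?_ (h.value j x) (abs_nonneg _) (by positivity)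
    refine (abs_add_le _ _).trans ?_
    rw [abs_mul, abs_of_pos (zero_lt_two' ℝ)]
  rw [abs_mul, abs_of_pos (by norm_num : (0 : ℝ) < 8)]
  calc _ ≤ 8 * ((2 * (A * S) + A * S) * (K * S⁻¹ * χ j)) := by
        gcongr
        refine (Finset.abs_sum_le_sum_abs _ _).trans ((Finset.sum_le_sum hterm).trans ?_)
        rw [← Finset.sum_mul, Finset.sum_add_distrib, ← Finset.mul_sum]
        gcongr
    _ = _ := by field_simp; ring

lemma abs_theta_le (j : ℕ) :
    |theta C j| ≤ 2 * K * (8 * L ^ 2 * K) * (81 * L ^ 4 * K * (L ^ 2 + 2)) * χ j := by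
  have hL0 : 0 < L := by lia
  rw [theta_eq (by lia) h.range]
  set A : ℝ := 81 * L ^ 4 * K with hA
  set D : ℝ := 8 * L ^ 2 * K with hD
  have hw := h.sum_abs_w_le hL hK hχ0 hχ1 (Nat.pow_le_pow_right hL0 j.le_succ)
  have hw' := h.sum_abs_w_le hL hK hχ0 hχ1 (j := j + 1) le_rfl
  have hpow : (L : ℝ) ^ (2 * (j + 1)) = (L : ℝ) ^ (2 * j) * L ^ 2 := by
    rw [show 2 * (j + 1) = 2 * j + 2 by ring, pow_add]
  rw [hpow] at hw'
  set S : ℝ := (L : ℝ) ^ (2 * j) with hS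
  have hS0 : 0 < S := by positivity
  have hχj := hχ0 j
  have hterm : ∀ x ∈ box (L ^ (j + 1)), |(x 0 : ℝ) ^ 2 * C (j + 1) x *
      (w C (j + 1) x ^ 2 + w C (j + 1) x * w C j x + w C j x ^ 2)|
      ≤ (|w C (j + 1) x| + 2 * |w C j x|) * (D * (K * S⁻¹ * χ j)) := by
    intro x _
    have hx : ∀ i, (x 0 : ℝ) ^ 2 * |w C i x| ≤ D := fun i =>
      (mul_le_mul_of_nonneg_right (sq_le_normSq x 0) (abs_nonneg _)).trans
        (h.normSq_mul_abs_w_le hL hK hχ1 i x)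
    have e : |w C (j + 1) x ^ 2 + w C (j + 1) x * w C j x + w C j x ^ 2|
        ≤ |w C (j + 1) x| * |w C (j + 1) x| + |w C (j + 1) x| * |w C j x| + |w C j x| * |w C j x| := by
      refine (abs_add_three _ _ _).trans (le_of_eq ?_)
      rw [abs_mul, abs_pow, abs_pow, sq, sq]
    have hv := h.value j x
    rw [abs_mul, abs_mul, abs_of_nonneg (sq_nonneg (x 0 : ℝ))]
    calc _ ≤ (x 0 : ℝ) ^ 2 * (K * S⁻¹ * χ j) * (|w C (j + 1) x| * |w C (j + 1) x|
          + |w C (j + 1) x| * |w C j x| + |w C j x| * |w C j x|) := by gcongr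
      _ = (((x 0 : ℝ) ^ 2 * |w C (j + 1) x|) * |w C (j + 1) x|
          + ((x 0 : ℝ) ^ 2 * |w C (j + 1) x|) * |w C j x|
          + ((x 0 : ℝ) ^ 2 * |w C j x|) * |w C j x|) * (K * S⁻¹ * χ j) := by ring
      _ ≤ (D * |w C (j + 1) x| + D * |w C j x| + D * |w C j x|) * (K * S⁻¹ * χ j) := by
          gcongr
          exacts [hx _, hx _, hx _]
      _ = _ := by ring
  rw [abs_mul, abs_of_pos (zero_lt_two' ℝ)]
  calc _ ≤ 2 * ((A * (S * L ^ 2) + 2 * (A * S)) * (D * (K * S⁻¹ * χ j))) := by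
        gcongr
        refine (Finset.abs_sum_le_sum_abs _ _).trans ((Finset.sum_le_sum hterm).trans ?_)
        rw [← Finset.sum_mul, Finset.sum_add_distrib, ← Finset.mul_sum]
        gcongr
    _ = _ := by field_simp

omit hL hK hχ0 hχ1 in
lemma abs_eta_le (hL : 1 ≤ L) (j : ℕ) :
    |(L : ℝ) ^ (2 * (j + 1)) * etaPrime C j| ≤ 2 * L ^ 2 * K * χ j := by
  have hS0 : 0 < (L : ℝ) ^ (2 * j) := by positivity
  have hv := h.value j 0
  rw [etaPrime, abs_mul, abs_mul, abs_of_pos (zero_lt_two' ℝ), abs_of_pos (by positivity),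
    show 2 * (j + 1) = 2 * j + 2 by ring, pow_add]
  calc _ ≤ (L : ℝ) ^ (2 * j) * L ^ 2 * (2 * (K * ((L : ℝ) ^ (2 * j))⁻¹ * χ j)) := by gcongr
    _ = _ := by field_simp

/-- The subtraction of `3 w^{(2)} C_{0,0}` in `ξ'` cancels the logarithmic growth of `w^{(2)}`. -/
lemma abs_xi_le (j : ℕ) :
    |(L : ℝ) ^ (2 * (j + 1)) * xiPrime C j| ≤
      (4 * L ^ 2 * (3 * (8 * L ^ 2 * K) + 4 * K) * K * (81 * L ^ 4 * K)
        + 1 / 4 * (24 * (81 * L ^ 4 * K) * K) * (2 * L ^ 2 * K)) * χ j := by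
  have hL0 : 0 < L := by lia
  have hβ := h.abs_beta_le hL hK hχ0 hχ1 j
  have hη := h.abs_eta_le hL0 j
  rw [xiPrime_eq (by lia) h.range]
  set A : ℝ := 81 * L ^ 4 * K with hA
  set D : ℝ := 8 * L ^ 2 * K with hD
  have hpow : (L : ℝ) ^ (2 * (j + 1)) = (L : ℝ) ^ (2 * j) * L ^ 2 := by
    rw [show 2 * (j + 1) = 2 * j + 2 by ring, pow_add]
  have hpow4 : (L : ℝ) ^ (4 * j) = (L : ℝ) ^ (2 * j) * (L : ℝ) ^ (2 * j) := by
    rw [← pow_add]; congr 1; ring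
  have hw := h.sum_abs_w_le hL hK hχ0 hχ1 (Nat.pow_le_pow_right hL0 j.le_succ)
  have hc' := h.sum_abs_le hL hK hχ0 j
  have hinc := h.increment j
  have hval := h.value j
  rw [hpow4] at hinc
  set S : ℝ := (L : ℝ) ^ (2 * j) with hS
  have hS0 : 0 < S := by positivity
  have hχj := hχ0 j
  have hc : ∑ x ∈ box (L ^ (j + 1)), |C (j + 1) x| ≤ A * S :=
    hc'.trans (mul_le_of_le_one_right (by positivity) (hχ1 j))
  have hS1 : K * S⁻¹ * χ j * (K * S⁻¹ * χ j) ≤ K * K * (S⁻¹ * S⁻¹ * χ j) := by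
    calc _ = K * K * (S⁻¹ * S⁻¹ * χ j) * χ j := by ring
      _ ≤ _ := mul_le_of_le_one_right (by positivity) (hχ1 j)
  have hterm : ∀ x ∈ box (L ^ (j + 1)), |3 * w C j x ^ 2 * (C (j + 1) x - C (j + 1) 0)
      + (3 * w C j x + C (j + 1) x) * C (j + 1) x ^ 2|
      ≤ (3 * D * K * |w C j x| + K * K * (3 * |w C j x| + |C (j + 1) x|)) * (S⁻¹ * S⁻¹ * χ j) := by
    intro x _
    have h1 : |3 * w C j x ^ 2 * (C (j + 1) x - C (j + 1) 0)|
        ≤ 3 * D * K * |w C j x| * (S⁻¹ * S⁻¹ * χ j) := by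
      rw [abs_mul, abs_mul, abs_pow, abs_of_pos (zero_lt_three' ℝ)]
      calc _ ≤ 3 * |w C j x| ^ 2 * (K * normSq x * (S * S)⁻¹ * χ j) := by
            gcongr; exact hinc x
        _ = 3 * |w C j x| * K * (S⁻¹ * S⁻¹ * χ j) * (normSq x * |w C j x|) := by
            rw [mul_inv]; ring
        _ ≤ 3 * |w C j x| * K * (S⁻¹ * S⁻¹ * χ j) * D := by
            gcongr
            exact h.normSq_mul_abs_w_le hL hK hχ1 j x
        _ = _ := by ring
    have h2 : |(3 * w C j x + C (j + 1) x) * C (j + 1) x ^ 2|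
        ≤ K * K * (3 * |w C j x| + |C (j + 1) x|) * (S⁻¹ * S⁻¹ * χ j) := by
      have h3 : |3 * w C j x + C (j + 1) x| ≤ 3 * |w C j x| + |C (j + 1) x| := by
        refine (abs_add_le _ _).trans ?_
        rw [abs_mul, abs_of_pos (zero_lt_three' ℝ)]
      have hv := hval x
      rw [abs_mul, abs_pow, sq]
      calc _ ≤ (3 * |w C j x| + |C (j + 1) x|) * (K * S⁻¹ * χ j * (K * S⁻¹ * χ j)) := by gcongr
        _ ≤ (3 * |w C j x| + |C (j + 1) x|) * (K * K * (S⁻¹ * S⁻¹ * χ j)) := by gcongr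
        _ = _ := by ring
    exact (abs_add_le _ _).trans ((add_le_add h1 h2).trans (add_mul _ _ _).ge)
  have hsum : |∑ x ∈ box (L ^ (j + 1)), (3 * w C j x ^ 2 * (C (j + 1) x - C (j + 1) 0)
      + (3 * w C j x + C (j + 1) x) * C (j + 1) x ^ 2)|
      ≤ (3 * D * K * (A * S) + K * K * (3 * (A * S) + A * S)) * (S⁻¹ * S⁻¹ * χ j) := by
    refine (Finset.abs_sum_le_sum_abs _ _).trans ((Finset.sum_le_sum hterm).trans ?_)
    rw [← Finset.sum_mul, Finset.sum_add_distrib, ← Finset.mul_sum, ← Finset.mul_sum,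
      Finset.sum_add_distrib, ← Finset.mul_sum]
    gcongr
  rw [mul_add]
  refine (abs_add_le _ _).trans ?_
  rw [add_mul]
  refine add_le_add ?_ ?_
  · rw [hpow, abs_mul, abs_mul (4 : ℝ), abs_of_pos (by norm_num : (0 : ℝ) < 4),
      abs_of_pos (by positivity)]
    calc _ ≤ S * L ^ 2 * (4 * ((3 * D * K * (A * S) + K * K * (3 * (A * S) + A * S))
          * (S⁻¹ * S⁻¹ * χ j))) := by gcongr
      _ = _ := by field_simp; ring
  · rw [mul_left_comm, abs_mul, abs_mul (1 / 4 : ℝ), abs_of_pos (by norm_num : (0 : ℝ) < 1 / 4)]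
    have hβ' : |beta C j| ≤ 24 * A * K := hβ.trans (mul_le_of_le_one_right (by positivity) (hχ1 j))
    calc _ ≤ 1 / 4 * (24 * A * K) * (2 * L ^ 2 * K * χ j) := by gcongr
      _ = _ := by ring

lemma abs_pi_le (j : ℕ) :
    |(L : ℝ) ^ (2 * (j + 1)) * piPrime C j| ≤ 6 * L ^ 2 * K * (81 * L ^ 4 * K) * χ j := by
  have hL0 : 0 < L := by lia
  rw [piPrime_eq (by lia) h.range]
  set A : ℝ := 81 * L ^ 4 * K with hA
  have hpow : (L : ℝ) ^ (2 * (j + 1)) = (L : ℝ) ^ (2 * j) * L ^ 2 := by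
    rw [show 2 * (j + 1) = 2 * j + 2 by ring, pow_add]
  have hpow4 : (L : ℝ) ^ (4 * j) = (L : ℝ) ^ (2 * j) * (L : ℝ) ^ (2 * j) := by
    rw [← pow_add]; congr 1; ring
  have hw := h.sum_abs_w_le hL hK hχ0 hχ1 (Nat.pow_le_pow_right hL0 j.le_succ)
  have hc' := h.sum_abs_le hL hK hχ0 j
  have hlap := h.laplacian j
  rw [hpow4] at hlap
  set S : ℝ := (L : ℝ) ^ (2 * j) with hS
  have hS0 : 0 < S := by positivity
  have hχj := hχ0 j
  have hc : ∑ x ∈ box (L ^ (j + 1)), |C (j + 1) x| ≤ A * S :=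
    hc'.trans (mul_le_of_le_one_right (by positivity) (hχ1 j))
  have hterm : ∀ x ∈ box (L ^ (j + 1)), |(2 * w C j x + C (j + 1) x) * lap (C (j + 1)) x|
      ≤ (2 * |w C j x| + |C (j + 1) x|) * (K * (S * S)⁻¹ * χ j) := by
    intro x _
    rw [abs_mul]
    refine mul_le_mul ?_ (hlap x) (abs_nonneg _) (by positivity)
    refine (abs_add_le _ _).trans ?_
    rw [abs_mul, abs_of_pos (zero_lt_two' ℝ)]
  rw [hpow, abs_mul, abs_mul (2 : ℝ), abs_of_pos (zero_lt_two' ℝ), abs_of_pos (by positivity)]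
  calc _ ≤ S * L ^ 2 * (2 * ((2 * (A * S) + A * S) * (K * (S * S)⁻¹ * χ j))) := by
        gcongr
        refine (Finset.abs_sum_le_sum_abs _ _).trans ((Finset.sum_le_sum hterm).trans ?_)
        rw [← Finset.sum_mul, Finset.sum_add_distrib, ← Finset.mul_sum]
        gcongr
    _ = _ := by field_simp; ring

end CovBounds

end

/-! ### Continuity of the coefficients -/

lemma continuousOn_tsum_box {s : Set ℝ} {F : ℝ → Lattice → ℝ} {n : ℕ}
    (hc : ∀ x, ContinuousOn (fun m2 => F m2 x) s) (h0 : ∀ m2 ∈ s, ∀ x, x ∉ box n → F m2 x = 0) :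
    ContinuousOn (fun m2 => ∑' x, F m2 x) s :=
  (continuousOn_finsetSum (box n) fun x _ => hc x).congr fun m2 hm => tsum_eq_sum_box (h0 m2 hm)

section Continuity

variable {s : Set ℝ} {F : ℝ → Lattice → ℝ} {n : ℕ} (hc : ∀ x, ContinuousOn (fun m2 => F m2 x) s)
  (h0 : ∀ m2 ∈ s, ∀ x, x ∉ box n → F m2 x = 0)

include hc h0

lemma continuousOn_powSum {p : ℕ} (hp : p ≠ 0) : ContinuousOn (fun m2 => powSum p (F m2)) s :=
  continuousOn_tsum_box (fun x => (hc x).pow p) fun m2 hm x hx => by rw [h0 m2 hm x hx, zero_pow hp]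

lemma continuousOn_secondMoment : ContinuousOn (fun m2 => secondMoment (F m2)) s :=
  continuousOn_tsum_box (fun x => continuousOn_const.mul (hc x))
    fun m2 hm x hx => by rw [h0 m2 hm x hx, mul_zero]

omit h0 in
lemma continuousOn_lap (x : Lattice) : ContinuousOn (fun m2 => lap (F m2) x) s :=
  continuousOn_finsetSum _ fun _ _ => ((hc _).add (hc _)).sub (continuousOn_const.mul (hc _))

omit h0 in
lemma continuousOn_gradSq (x : Lattice) : ContinuousOn (fun m2 => gradSq (F m2) x) s :=
  continuousOn_const.mul (continuousOn_finsetSum _ fun _ _ =>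
    (((hc _).sub (hc _)).pow 2).add (((hc _).sub (hc _)).pow 2))

omit hc in
lemma gradSq_eq_zero {m2 : ℝ} (hm : m2 ∈ s) {x : Lattice} (hx : x ∉ box (n + 1)) :
    gradSq (F m2) x = 0 := by
  have h1 : ∀ i, x + unit i ∉ box n := fun i h => hx (by simpa using (add_unit_mem_box h i).2)
  have h2 : ∀ i, x - unit i ∉ box n := fun i h => hx (by simpa using (add_unit_mem_box h i).1)
  have h3 : x ∉ box n := fun h => hx (box_mono n.le_succ h)
  simp [gradSq, h0 m2 hm _ (h1 _), h0 m2 hm _ (h2 _), h0 m2 hm _ h3]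

end Continuity

section FlowContinuity

variable {s : Set ℝ} {L : ℕ} (hL : 1 ≤ L) {C : ℝ → ℕ → Lattice → ℝ}
  (hc : ∀ j x, ContinuousOn (fun m2 => C m2 j x) s)
  (h0 : ∀ m2 ∈ s, ∀ j x, x ∉ box (L ^ j) → C m2 j x = 0)

include hc in
lemma continuousOn_w (j : ℕ) (x : Lattice) : ContinuousOn (fun m2 => w (C m2) j x) s :=
  continuousOn_finsetSum _ fun i _ => hc i x

include hc in
lemma continuousOn_etaPrime (j : ℕ) : ContinuousOn (fun m2 => etaPrime (C m2) j) s :=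
  continuousOn_const.mul (hc _ _)

include hL h0 in
lemma w_eq_zero_of_mem {m2 : ℝ} (hm : m2 ∈ s) (j : ℕ) (x : Lattice) (hx : x ∉ box (L ^ j)) :
    w (C m2) j x = 0 :=
  w_eq_zero hL (h0 m2 hm) le_rfl hx

include hL hc h0

lemma continuousOn_powSum_w {p : ℕ} (hp : p ≠ 0) (j : ℕ) :
    ContinuousOn (fun m2 => powSum p (w (C m2) j)) s :=
  continuousOn_powSum (continuousOn_w hc j) (fun _ hm => w_eq_zero_of_mem hL h0 hm j) hp

lemma continuousOn_beta (j : ℕ) : ContinuousOn (fun m2 => beta (C m2) j) s :=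
  continuousOn_const.mul ((continuousOn_powSum_w hL hc h0 two_ne_zero _).sub
    (continuousOn_powSum_w hL hc h0 two_ne_zero _))

lemma continuousOn_secondMoment_w_pow {p : ℕ} (hp : p ≠ 0) (j : ℕ) :
    ContinuousOn (fun m2 => secondMoment fun x => w (C m2) j x ^ p) s :=
  continuousOn_secondMoment (fun x => (continuousOn_w hc j x).pow p)
    fun _ hm x hx => by rw [w_eq_zero_of_mem hL h0 hm j x hx, zero_pow hp]

lemma continuousOn_theta (j : ℕ) : ContinuousOn (fun m2 => theta (C m2) j) s :=
  continuousOn_const.mul ((continuousOn_secondMoment_w_pow hL hc h0 three_ne_zero _).sub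
    (continuousOn_secondMoment_w_pow hL hc h0 three_ne_zero _))

lemma continuousOn_xiPrime (j : ℕ) : ContinuousOn (fun m2 => xiPrime (C m2) j) s :=
  (continuousOn_const.mul (((continuousOn_powSum_w hL hc h0 three_ne_zero _).sub
    (continuousOn_powSum_w hL hc h0 three_ne_zero _)).sub
    ((continuousOn_const.mul (continuousOn_powSum_w hL hc h0 two_ne_zero _)).mul (hc _ _)))).add
    ((continuousOn_const.mul (continuousOn_beta hL hc h0 j)).mul (continuousOn_etaPrime hc j))

lemma continuousOn_powSum_w_lap (j : ℕ) :
    ContinuousOn (fun m2 => powSum 1 fun x => w (C m2) j x * lap (w (C m2) j) x) s :=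
  continuousOn_powSum (F := fun m2 x => w (C m2) j x * lap (w (C m2) j) x)
    (fun x => (continuousOn_w hc j x).mul (continuousOn_lap (continuousOn_w hc j) x))
    (fun _ hm x hx => by rw [w_eq_zero_of_mem hL h0 hm j x hx, zero_mul]) one_ne_zero

lemma continuousOn_piPrime (j : ℕ) : ContinuousOn (fun m2 => piPrime (C m2) j) s :=
  continuousOn_const.mul ((continuousOn_powSum_w_lap hL hc h0 _).sub
    (continuousOn_powSum_w_lap hL hc h0 _))

lemma continuousOn_secondMoment_w_lap (j : ℕ) :
    ContinuousOn (fun m2 => secondMoment fun x => w (C m2) j x * lap (w (C m2) j) x) s :=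
  continuousOn_secondMoment
    (fun x => (continuousOn_w hc j x).mul (continuousOn_lap (continuousOn_w hc j) x))
    fun _ hm x hx => by rw [w_eq_zero_of_mem hL h0 hm j x hx, zero_mul]

lemma continuousOn_sigma (j : ℕ) : ContinuousOn (fun m2 => sigma (C m2) j) s :=
  (continuousOn_secondMoment_w_lap hL hc h0 _).sub (continuousOn_secondMoment_w_lap hL hc h0 _)

lemma continuousOn_secondMoment_gradSq_w (j : ℕ) :
    ContinuousOn (fun m2 => secondMoment (gradSq (w (C m2) j))) s :=
  continuousOn_secondMoment (F := fun m2 => gradSq (w (C m2) j))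
    (continuousOn_gradSq (continuousOn_w hc j))
    fun _ hm _ hx => gradSq_eq_zero (fun _ hm => w_eq_zero_of_mem hL h0 hm j) hm hx

lemma continuousOn_zeta (j : ℕ) : ContinuousOn (fun m2 => zeta (C m2) j) s :=
  (continuousOn_secondMoment_gradSq_w hL hc h0 _).sub (continuousOn_secondMoment_gradSq_w hL hc h0 _)

lemma continuousOn_w1 (j : ℕ) : ContinuousOn (fun m2 => w1 (C m2) j) s :=
  continuousOn_powSum_w hL hc h0 one_ne_zero j

lemma continuousOn_wStar (j : ℕ) : ContinuousOn (fun m2 => wStar (C m2) j) s :=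
  continuousOn_secondMoment (continuousOn_w hc j) fun _ hm => w_eq_zero_of_mem hL h0 hm j

lemma continuousOn_wSqStar (j : ℕ) : ContinuousOn (fun m2 => wSqStar (C m2) j) s :=
  continuousOn_secondMoment_w_pow hL hc h0 two_ne_zero j

lemma continuousOn_phiPt (a b : Lattice) (jab : ℤ) (j : ℕ) (V : Coupling → ℂ) :
    ContinuousOn (fun m2 => phiPt (C m2) a b jab j V) s := by
  have cast : ∀ {f : ℝ → ℝ}, ContinuousOn f s → ContinuousOn (fun m2 => (f m2 : ℂ)) s :=
    fun hf => Complex.continuous_ofReal.comp_continuousOn hf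
  have hβ := cast (continuousOn_beta hL hc h0 j)
  have hθ := cast (continuousOn_theta hL hc h0 j)
  have hη := cast (continuousOn_etaPrime hc j)
  have hξ := cast (continuousOn_xiPrime hL hc h0 j)
  have hπ := cast (continuousOn_piPrime hL hc h0 j)
  have hσ := cast (continuousOn_sigma hL hc h0 j)
  have hζ := cast (continuousOn_zeta hL hc h0 j)
  have hw1 := cast (continuousOn_w1 hL hc h0 j)
  have hw1' := cast (continuousOn_w1 hL hc h0 (j + 1))
  have hws := cast (continuousOn_wStar hL hc h0 j)
  have hws' := cast (continuousOn_wStar hL hc h0 (j + 1))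
  have hwq := cast (continuousOn_wSqStar hL hc h0 j)
  have hwq' := cast (continuousOn_wSqStar hL hc h0 (j + 1))
  have hC := cast (hc (j + 1) (b - a))
  have hnu : ContinuousOn (fun m2 => V .nu + (etaPrime (C m2) j : ℂ) * V .g) s :=
    continuousOn_const.add (hη.mul continuousOn_const)
  have hdw := (hnu.mul hw1').sub (continuousOn_const (c := V .nu) |>.mul hw1)
  have hy : ContinuousOn (fun m2 => phiPt (C m2) a b jab j V .y) s := by
    simp only [phiPt]
    exact ((continuousOn_const.add ((hσ.mul continuousOn_const).mul continuousOn_const)).sub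
      ((hζ.mul continuousOn_const).mul continuousOn_const)).sub
      (continuousOn_const.mul ((hnu.mul hwq').sub (continuousOn_const.mul hwq)))
  have hlam : ∀ lam : ℂ, ContinuousOn (fun m2 => if (j : ℤ) + 1 < jab then
      (1 - ((V .nu + (etaPrime (C m2) j : ℂ) * V .g) * (w1 (C m2) (j + 1) : ℂ)
        - V .nu * (w1 (C m2) j : ℂ))) * lam else lam) s := by
    intro lam
    split_ifs
    · exact (continuousOn_const.sub hdw).mul continuousOn_const
    · exact continuousOn_const
  refine continuousOn_pi.2 fun v => ?_
  cases v with
  | g => exact (continuousOn_const.sub (hβ.mul continuousOn_const)).sub (continuousOn_const.mul hdw)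
  | nu =>
    exact (((((continuousOn_const.add (hη.mul (continuousOn_const.add (continuousOn_const.mul hw1)))).sub
      (hξ.mul continuousOn_const)).sub (((continuousOn_const.mul hβ).mul continuousOn_const).mul
      continuousOn_const)).sub ((hπ.mul continuousOn_const).mul continuousOn_const)).sub
      (((hnu.pow 2).mul hw1').sub (continuousOn_const.mul hw1)))
  | y => exact hy
  | z =>
    exact (((continuousOn_const.sub (hθ.mul continuousOn_const)).sub (continuousOn_const.mul
      (((hnu.pow 2).mul hws').sub (continuousOn_const.mul hws)))).sub
      (continuousOn_const.mul hdw)).sub (hy.sub continuousOn_const)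
  | lamA => exact hlam _
  | lamB => exact hlam _
  | qA => exact continuousOn_const.add (continuousOn_const.mul hC)
  | qB => exact continuousOn_const.add (continuousOn_const.mul hC)

end FlowContinuity

/-! ### The scales -/

lemma supNorm_le {β : ℕ → ℝ} {M : ℝ} (h : ∀ j, |β j| ≤ M) : supNorm β ≤ M := ciSup_le h

lemma le_supNorm {β : ℕ → ℝ} {M : ℝ} (h : ∀ j, |β j| ≤ M) (j : ℕ) : |β j| ≤ supNorm β :=
  le_ciSup (f := fun j => |β j|) ⟨M, by rintro _ ⟨j, rfl⟩; exact h j⟩ j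

lemma jOmega_le {Ω : ℝ} {β : ℕ → ℝ} {k : ℕ}
    (h : ∀ j : ℕ, |β j| ≤ Ω ^ (-((j : ℤ) - (k : ℤ))) * supNorm β) : jOmega Ω β ≤ k :=
  sInf_le ⟨k, rfl, h⟩

/-- A finite `j_Ω` is attained. -/
lemma abs_le_of_jOmega_eq {Ω : ℝ} {β : ℕ → ℝ} {n : ℕ} (h : jOmega Ω β = n) (j : ℕ) :
    |β j| ≤ Ω ^ (-((j : ℤ) - (n : ℤ))) * supNorm β := by
  have hne : {n : ℕ∞ | ∃ k : ℕ, n = k ∧ ∀ j : ℕ, |β j| ≤ Ω ^ (-((j : ℤ) - (k : ℤ))) * supNorm β}.Nonempty := by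
    by_contra hne
    rw [Set.not_nonempty_iff_eq_empty] at hne
    rw [jOmega, hne, sInf_empty] at h
    exact ENat.top_ne_natCast n h
  obtain ⟨k, hk, hkj⟩ := csInf_mem hne
  have : n = k := by
    have h' : (n : ℕ∞) = k := h.symm.trans hk
    exact_mod_cast h'
  rw [this]
  exact hkj j

lemma decay_coe (Ω : ℝ) (n j : ℕ) : decay Ω n j = (Ω ^ (j - n))⁻¹ := by
  rw [decay, ← ENat.natCast_sub, ENat.toNat_natCast]

lemma decay_top (Ω : ℝ) (j : ℕ) : decay Ω ⊤ j = 1 := by simp [decay]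

lemma massScale_zero (L : ℕ) : massScale L 0 = ⊤ := by simp [massScale]

/-- The mass scale `l` is characterised by `L^{2l} ≤ m⁻² < L^{2(l+1)}`. -/
lemma exists_massScale_eq {L : ℕ} (hL : 2 ≤ L) {m2 : ℝ} (hm : 0 < m2) :
    ∃ l : ℤ, massScale L m2 = (l : WithTop ℤ) ∧ ((L : ℝ) ^ 2) ^ l ≤ m2⁻¹ ∧ m2⁻¹ < ((L : ℝ) ^ 2) ^ (l + 1) := by
  have h1 : 1 < L ^ 2 := Nat.one_lt_pow two_ne_zero (by lia)
  refine ⟨Int.log (L ^ 2) m2⁻¹, ?_, ?_, ?_⟩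
  · rw [massScale, if_pos hm, ← Real.floor_logb_natCast (by positivity)]
    push_cast
    rfl
  · have := Int.zpow_log_le_self h1 (inv_pos.2 hm)
    exact_mod_cast this
  · have := Int.lt_zpow_succ_log_self h1 m2⁻¹
    exact_mod_cast this

/-- Above the mass scale `l` the decay factor is geometric. -/
lemma massDecay_le_zpow {Ω R : ℝ} (hΩ : 1 < Ω) (hR0 : 0 < R) {L s : ℕ} (hL : 2 ≤ L)
    (hs : Ω ≤ ((L : ℝ) ^ 2) ^ s) {m2 : ℝ} (hm : 0 < m2) {l : ℤ} (hl : m2⁻¹ < ((L : ℝ) ^ 2) ^ (l + 1)) (j : ℕ) :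
    massDecay R L s m2 j ≤ max 1 ((4 * R) ^ s) * Ω ^ (l + 1 - j) := by
  have hL2 : (2 : ℝ) ≤ L := by exact_mod_cast hL
  have hΩ0 : 0 < Ω := by linarith
  rcases lt_or_ge (j : ℤ) (l + 1) with hj | hj
  · refine (massDecay_le_one hR0 hm.le L s j).trans ?_
    exact one_le_mul_of_one_le_of_one_le (le_max_left _ _) (one_le_zpow₀ hΩ.le (by lia))
  · obtain ⟨d, hd⟩ := Int.eq_ofNat_of_zero_le (sub_nonneg.2 hj)
    have hd' : (l + 1 - j : ℤ) = -(d : ℤ) := by lia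
    have hmd : ((L : ℝ) ^ 2) ^ d ≤ m2 * (L : ℝ) ^ (2 * j) := by
      have h1 : 1 ≤ m2 * ((L : ℝ) ^ 2) ^ (l + 1) := by
        rw [inv_lt_iff_one_lt_mul₀ hm] at hl
        linarith
      have h2 : (L : ℝ) ^ (2 * j) = ((L : ℝ) ^ 2) ^ (l + 1) * ((L : ℝ) ^ 2) ^ d := by
        rw [pow_mul, ← zpow_natCast _ j, ← zpow_natCast _ d, ← zpow_add₀ (by positivity)]
        congr 1
        lia
      rw [h2, ← mul_assoc]
      exact le_mul_of_one_le_left (by positivity) h1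
    rw [hd', zpow_neg, zpow_natCast]
    calc massDecay R L s m2 j ≤ ((m2 * (L : ℝ) ^ (2 * j) / (4 * R)) ^ s)⁻¹ := by
          unfold massDecay
          gcongr
          linarith
      _ ≤ ((((L : ℝ) ^ 2) ^ d / (4 * R)) ^ s)⁻¹ := by gcongr
      _ = (4 * R) ^ s * ((((L : ℝ) ^ 2) ^ s) ^ d)⁻¹ := by
          rw [div_pow, inv_div, div_eq_mul_inv, pow_right_comm]
      _ ≤ max 1 ((4 * R) ^ s) * (Ω ^ d)⁻¹ := by
          gcongr
          exact le_max_right _ _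

/-! ### Uniform bounds on the transformed flow -/

/-- The coefficients of the flow are bounded by the decay factor, uniformly in the mass. -/
lemma exists_barFlow_le {φ : SchwartzMap ℝ ℝ} (hφ : IsProfile φ) {R mbar2 : ℝ} (hmbar : 0 ≤ mbar2)
    (hR : 16 + mbar2 ≤ 4 * R) {L : ℕ} (hL : 2 ≤ L) (s : ℕ) :
    ∃ K, 0 ≤ K ∧ ∀ m2 ∈ Set.Icc 0 mbar2, ∀ j,
      |(barFlow L (cov φ R L m2)).beta j| ≤ K * massDecay R L s m2 j ∧
      |(barFlow L (cov φ R L m2)).theta j| ≤ K * massDecay R L s m2 j ∧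
      |(barFlow L (cov φ R L m2)).eta j| ≤ K * massDecay R L s m2 j ∧
      |(barFlow L (cov φ R L m2)).xi j| ≤ K * massDecay R L s m2 j ∧
      |(barFlow L (cov φ R L m2)).omega j| ≤ K * massDecay R L s m2 j ∧
      |(barFlow L (cov φ R L m2)).pi j| ≤ K * massDecay R L s m2 j := by
  have hR0 : 0 < R := by linarith
  obtain ⟨K, hK, hC⟩ := exists_covBounds hφ hmbar hR hL s
  set Kβ : ℝ := 24 * (81 * L ^ 4 * K) * K with hKβ
  set Kθ : ℝ := 2 * K * (8 * L ^ 2 * K) * (81 * L ^ 4 * K * (L ^ 2 + 2)) with hKθ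
  set Kη : ℝ := 2 * L ^ 2 * K with hKη
  set Kξ : ℝ := 4 * L ^ 2 * (3 * (8 * L ^ 2 * K) + 4 * K) * K * (81 * L ^ 4 * K)
        + 1 / 4 * (24 * (81 * L ^ 4 * K) * K) * (2 * L ^ 2 * K) with hKξ
  set Kπ : ℝ := 6 * L ^ 2 * K * (81 * L ^ 4 * K) with hKπ
  have hβ0 : 0 ≤ Kβ := by positivity
  have hθ0 : 0 ≤ Kθ := by positivity
  have hη0 : 0 ≤ Kη := by positivity
  have hξ0 : 0 ≤ Kξ := by positivity
  have hπ0 : 0 ≤ Kπ := by positivity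
  have hω0 : 0 ≤ (L : ℝ) ^ 2 * (1 / 4) * Kβ := by positivity
  refine ⟨Kβ + Kθ + Kη + Kξ + (L : ℝ) ^ 2 * (1 / 4) * Kβ + Kπ, by positivity, fun m2 hm j => ?_⟩
  have h := hC m2 hm
  have hχ0 := fun j => (massDecay_pos hR0 hm.1 L s j).le
  have hχ1 := fun j => massDecay_le_one hR0 hm.1 L s j
  have hmono : ∀ {a b x : ℝ}, a ≤ b → |x| ≤ a * massDecay R L s m2 j →
      |x| ≤ b * massDecay R L s m2 j := fun hab hx =>
    hx.trans (mul_le_mul_of_nonneg_right hab (hχ0 j))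
  have hβ := h.abs_beta_le hL hK hχ0 hχ1 j
  refine ⟨hmono ?_ hβ, hmono ?_ (h.abs_theta_le hL hK hχ0 hχ1 j), hmono ?_ (h.abs_eta_le (by lia) j),
    hmono ?_ (h.abs_xi_le hL hK hχ0 hχ1 j), hmono (a := (L : ℝ) ^ 2 * (1 / 4) * Kβ) ?_ ?_,
    hmono ?_ (h.abs_pi_le hL hK hχ0 hχ1 j)⟩
  any_goals linarith
  simp only [barFlow]
  rw [abs_mul, abs_of_nonneg (by positivity : 0 ≤ (L : ℝ) ^ 2 * (1 / 4)), mul_assoc _ Kβ]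
  exact mul_le_mul_of_nonneg_left hβ (by positivity)

/-- `β_j` is bounded below between a fixed scale and the mass scale: `w_j` and `C_{j+1}` have a
non-negative pairing, so that `β_j ≥ 8 ∑ₓ C_{j+1}(x)²`. -/
lemma exists_le_beta {φ : SchwartzMap ℝ ℝ} (hφ : IsProfile φ) {R mbar2 : ℝ} (hmbar : 0 ≤ mbar2)
    (hR : 16 + mbar2 ≤ 4 * R) {L : ℕ} (hL : 2 ≤ L) :
    ∃ c ε : ℝ, ∃ j₀ : ℕ, 0 < c ∧ 0 < ε ∧ ∀ m2 ∈ Set.Icc 0 mbar2, ∀ j, j₀ ≤ j →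
      m2 * (L : ℝ) ^ (2 * j) ≤ ε → c ≤ beta (cov φ R L m2) j := by
  obtain ⟨c, ε, j₀, hc, hε, h⟩ := hφ.exists_le_sum_cov_sq hmbar hR hL
  refine ⟨c, ε, j₀, hc, hε, fun m2 hm j hj hmj => ?_⟩
  have hR' : 16 + m2 ≤ 4 * R := by linarith [hm.2]
  have h1 := h m2 hm j hj hmj
  rw [beta_eq (by lia) fun j x hx => hφ.cov_eq_zero hm.1 hR' (by lia) hx, Finset.sum_add_distrib,
    ← Finset.mul_sum]
  have h2 : 0 ≤ ∑ x ∈ box (L ^ (j + 1)), w (cov φ R L m2) j x * cov φ R L m2 (j + 1) x := by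
    simp only [w, Finset.sum_mul]
    rw [Finset.sum_comm]
    refine Finset.sum_nonneg fun i hi => hφ.sum_cov_mul_cov_nonneg hm.1 hR' (by lia) ?_ (j + 1)
    exact Nat.pow_le_pow_right (by lia) ((Finset.mem_Icc.1 hi).2.trans j.le_succ)
  linarith

/-! ### Comparison of `j_Ω` with the mass scale -/

lemma assumptionA1_of_subset {Ω M c : ℝ} {N : ℕ} {F : BarFlow} (hM : ∀ j, |F.beta j| ≤ M)
    (S : Finset ℕ) (hS : S.card ≤ N) (hc : c ≤ ((N : ℝ) + 1)⁻¹) (hc0 : 0 < c)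
    (h : ∀ j : ℕ, (j : ℕ∞) ≤ jOmega Ω F.beta → F.beta j < c → j ∈ S) : AssumptionA1 Ω M c F := by
  have hsub : {j : ℕ | (j : ℕ∞) ≤ jOmega Ω F.beta ∧ F.beta j < c} ⊆ (S : Set ℕ) :=
    fun j hj => h j hj.1 hj.2
  refine ⟨hM, S.finite_toSet.subset hsub, ?_⟩
  have h1 := Set.ncard_le_ncard hsub S.finite_toSet
  rw [Set.ncard_coe_finset] at h1
  have h2 : (({j : ℕ | (j : ℕ∞) ≤ jOmega Ω F.beta ∧ F.beta j < c}.ncard : ℕ) : ℝ) ≤ N := by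
    exact_mod_cast h1.trans hS
  refine h2.trans ?_
  rw [le_inv_comm₀ hc0 (by positivity)] at hc
  linarith

/-- If the coefficients of a flow are bounded by `K Ω^{l+1-j}` and `β_j ≥ c` for `j₀ ≤ j ≤ l - q`,
then `j_Ω` differs from `l` by a constant, and (A1), (A2) hold. Here `Ω^p` compensates the
ratio `K / c`. -/
lemma scale_estimates {Ω K c : ℝ} {p q j₀ : ℕ} {l : ℤ} {F : BarFlow} (hΩ : 1 < Ω)
    (hc : 0 < c) (hp : K ≤ c * Ω ^ p) (hl : (j₀ : ℤ) + q ≤ l)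
    (hbd : ∀ j, |F.beta j| ≤ K)
    (hβ : ∀ j : ℕ, |F.beta j| ≤ K * Ω ^ (l + 1 - j))
    (hlow : ∀ j : ℕ, j₀ ≤ j → (j : ℤ) ≤ l - q → c ≤ F.beta j) :
    ∃ n : ℕ, jOmega Ω F.beta = n ∧ l - q - p ≤ n ∧ (n : ℤ) ≤ l + 1 + p ∧
      AssumptionA1 Ω K (min c ((j₀ + (1 + p + q) : ℕ) + 1 : ℝ)⁻¹) F := by
  have hΩ0 : 0 < Ω := by linarith
  obtain ⟨m, rfl⟩ := Int.eq_ofNat_of_zero_le (by lia : 0 ≤ l)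
  have hl' : j₀ + q ≤ m := by lia
  have hsup : c ≤ supNorm F.beta :=
    (hlow j₀ le_rfl (by lia)).trans ((le_abs_self _).trans (le_supNorm hbd j₀))
  have hle : jOmega Ω F.beta ≤ (m + 1 + p : ℕ) := by
    refine jOmega_le fun j => (hβ j).trans ?_
    have e : -((j : ℤ) - ((m + 1 + p : ℕ) : ℤ)) = (p : ℤ) + ((m : ℤ) + 1 - j) := by push_cast; ring
    rw [e, zpow_add₀ hΩ0.ne', zpow_natCast]
    calc K * Ω ^ ((m : ℤ) + 1 - j) ≤ c * Ω ^ p * Ω ^ ((m : ℤ) + 1 - j) := by gcongr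
      _ = Ω ^ p * Ω ^ ((m : ℤ) + 1 - j) * c := by ring
      _ ≤ _ := by gcongr
  obtain ⟨n, hn⟩ := ENat.ne_top_iff_exists.1 (ne_top_of_le_ne_top (ENat.natCast_ne_top _) hle)
  have hn' : jOmega Ω F.beta = n := hn.symm
  have hnle : n ≤ m + 1 + p := by
    rw [hn'] at hle
    exact_mod_cast hle
  refine ⟨n, hn', ?_, by lia, ?_⟩
  · have h1 := (hlow (m - q) (by lia) (by lia)).trans
      ((le_abs_self _).trans (abs_le_of_jOmega_eq hn' (m - q)))
    have h2 : c * 1 ≤ c * Ω ^ ((p : ℤ) + -(((m - q : ℕ) : ℤ) - n)) := by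
      rw [zpow_add₀ hΩ0.ne', zpow_natCast, mul_one]
      calc c ≤ _ := h1
        _ ≤ Ω ^ (-(((m - q : ℕ) : ℤ) - n)) * (c * Ω ^ p) := by
          gcongr
          exact (supNorm_le hbd).trans hp
        _ = _ := by ring
    have h3 := (one_le_zpow_iff_right₀ hΩ).1 (le_of_mul_le_mul_left h2 hc)
    lia
  · refine assumptionA1_of_subset hbd (Finset.range j₀ ∪ Finset.Ioc (m - q) n) ?_ (min_le_right _ _)
      (by positivity) fun j hj hjc => ?_
    · refine (Finset.card_union_le _ _).trans ?_
      rw [Finset.card_range, Nat.card_Ioc]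
      lia
    · rw [hn'] at hj
      have hjn : j ≤ n := by exact_mod_cast hj
      rw [Finset.mem_union, Finset.mem_range, Finset.mem_Ioc]
      by_contra! hcon
      have h1 := hlow j hcon.1 (by have := hcon.2; lia)
      have h2 := min_le_left c ((j₀ + (1 + p + q) : ℕ) + 1 : ℝ)⁻¹
      linarith

/-- If `β_j` is bounded below at all large scales, then `j_Ω = ∞`. -/
lemma jOmega_eq_top {Ω K c : ℝ} {j₀ : ℕ} {β : ℕ → ℝ} (hΩ : 1 < Ω) (hc : 0 < c)
    (hbd : ∀ j, |β j| ≤ K) (hlow : ∀ j, j₀ ≤ j → c ≤ β j) : jOmega Ω β = ⊤ := by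
  have hΩ0 : 0 < Ω := by linarith
  obtain ⟨p, hp⟩ := pow_unbounded_of_one_lt (K / c) hΩ
  rw [div_lt_iff₀ hc] at hp
  by_contra h
  obtain ⟨n, hn⟩ := ENat.ne_top_iff_exists.1 h
  have h1 := (hlow (j₀ + n + p) (by lia)).trans
    ((le_abs_self _).trans (abs_le_of_jOmega_eq hn.symm (j₀ + n + p)))
  have h2 : Ω ^ (-(((j₀ + n + p : ℕ) : ℤ) - n)) ≤ (Ω ^ p)⁻¹ := by
    rw [← zpow_natCast, ← zpow_neg]
    exact zpow_le_zpow_right₀ hΩ.le (by push_cast; lia)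
  have h3 : Ω ^ (-(((j₀ + n + p : ℕ) : ℤ) - n)) * supNorm β < c := by
    calc _ ≤ (Ω ^ p)⁻¹ * K := by
          have hs := supNorm_le hbd
          have hK : 0 ≤ K := (abs_nonneg _).trans (hbd 0)
          calc _ ≤ Ω ^ (-(((j₀ + n + p : ℕ) : ℤ) - n)) * K := by gcongr
            _ ≤ _ := by gcongr
      _ < c := by
          rw [inv_mul_lt_iff₀ (by positivity)]
          exact hp
  linarith

/-- Bounds by the decay factor beyond the mass scale `l` become bounds by `Ω^{-(j - n)_+}` at the
cost of a constant, if `n` is at least `l + 1 - r`. -/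
lemma le_mul_decay {Ω K χ : ℝ} {l : ℤ} {n r j : ℕ} (hΩ : 1 < Ω) (hK : 1 ≤ K) (hχ1 : χ ≤ 1)
    (hχ : χ ≤ K * Ω ^ (l + 1 - j)) (hn : l + 1 - r ≤ n) : χ ≤ K * Ω ^ r * decay Ω n j := by
  have hΩ0 : 0 < Ω := by linarith
  rw [decay_coe]
  rcases le_total j n with hj | hj
  · rw [Nat.sub_eq_zero_of_le hj, pow_zero, inv_one, mul_one]
    exact hχ1.trans (one_le_mul_of_one_le_of_one_le hK (one_le_pow₀ hΩ.le))
  · refine hχ.trans ?_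
    rw [mul_assoc]
    gcongr
    rw [← zpow_natCast, ← zpow_natCast, ← zpow_neg, ← zpow_add₀ hΩ0.ne']
    exact zpow_le_zpow_right₀ hΩ.le (by lia)

end PerturbativeFlow

end

open PerturbativeFlow in
theorem proposition4p4 (φ : SchwartzMap ℝ ℝ) (hφ : IsProfile φ) (L : ℕ) (hL : 2 ≤ L)
    (mbar2 : ℝ) (hmbar2 : 0 < mbar2) (R : ℝ) (hR : 16 + mbar2 ≤ 4 * R) :
    -- continuity in the mass of the coefficients of the flow of the coupling constants,
    -- and of the map that they define
    (∀ j : ℕ,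
      ContinuousOn (fun m2 => beta (cov φ R L m2) j) (Set.Icc 0 mbar2) ∧
      ContinuousOn (fun m2 => theta (cov φ R L m2) j) (Set.Icc 0 mbar2) ∧
      ContinuousOn (fun m2 => etaPrime (cov φ R L m2) j) (Set.Icc 0 mbar2) ∧
      ContinuousOn (fun m2 => xiPrime (cov φ R L m2) j) (Set.Icc 0 mbar2) ∧
      ContinuousOn (fun m2 => piPrime (cov φ R L m2) j) (Set.Icc 0 mbar2) ∧
      ContinuousOn (fun m2 => sigma (cov φ R L m2) j) (Set.Icc 0 mbar2) ∧
      ContinuousOn (fun m2 => zeta (cov φ R L m2) j) (Set.Icc 0 mbar2) ∧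
      ContinuousOn (fun m2 => w1 (cov φ R L m2) j) (Set.Icc 0 mbar2) ∧
      ContinuousOn (fun m2 => wStar (cov φ R L m2) j) (Set.Icc 0 mbar2) ∧
      ContinuousOn (fun m2 => wSqStar (cov φ R L m2) j) (Set.Icc 0 mbar2) ∧
      (∀ a b : Lattice,
        ContinuousOn (fun m2 => cov φ R L m2 (j + 1) (b - a)) (Set.Icc 0 mbar2)) ∧
      (∀ (a b : Lattice) (jab : ℤ) (V : Coupling → ℂ),
        ContinuousOn (fun m2 => phiPt (cov φ R L m2) a b jab j V) (Set.Icc 0 mbar2))) ∧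
    -- the same for the transformed flow
    (∀ j : ℕ,
      ContinuousOn (fun m2 => (barFlow L (cov φ R L m2)).beta j) (Set.Icc 0 mbar2) ∧
      ContinuousOn (fun m2 => (barFlow L (cov φ R L m2)).theta j) (Set.Icc 0 mbar2) ∧
      ContinuousOn (fun m2 => (barFlow L (cov φ R L m2)).eta j) (Set.Icc 0 mbar2) ∧
      ContinuousOn (fun m2 => (barFlow L (cov φ R L m2)).xi j) (Set.Icc 0 mbar2) ∧
      ContinuousOn (fun m2 => (barFlow L (cov φ R L m2)).omega j) (Set.Icc 0 mbar2) ∧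
      ContinuousOn (fun m2 => (barFlow L (cov φ R L m2)).pi j) (Set.Icc 0 mbar2) ∧
      (∀ V : ℝ × ℝ × ℝ,
        ContinuousOn (fun m2 => (barFlow L (cov φ R L m2)).map j V) (Set.Icc 0 mbar2))) ∧
    (∀ Ω : ℝ, 1 < Ω → ∃ δ : ℝ, 0 < δ ∧ δ ≤ mbar2 ∧
      -- (A1) and (A2), with constants that are uniform in the mass
      (∃ M c K : ℝ, 0 < c ∧ ∀ m2 ∈ Set.Icc 0 δ,
        AssumptionA1 Ω M c (barFlow L (cov φ R L m2)) ∧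
        AssumptionA2 Ω K (barFlow L (cov φ R L m2))) ∧
      -- comparison of the two scales
      (∃ K : ℝ, ∀ m2 ∈ Set.Ioc 0 δ, ∃ (n : ℕ) (l : ℤ),
        jOmega Ω (barFlow L (cov φ R L m2)).beta = (n : ℕ∞) ∧
        massScale L m2 = (l : WithTop ℤ) ∧ |(n : ℝ) - (l : ℝ)| ≤ K) ∧
      massScale L 0 = ⊤ ∧ jOmega Ω (barFlow L (cov φ R L 0)).beta = ⊤) := by
  have hL1 : 1 ≤ L := by lia
  have hR0 : 0 < R := by linarith
  have hc : ∀ j x, ContinuousOn (fun m2 => cov φ R L m2 j x) (Set.Icc 0 mbar2) :=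
    hφ.continuousOn_cov hR hL1
  have h0 : ∀ m2 ∈ Set.Icc 0 mbar2, ∀ j x, x ∉ box (L ^ j) → cov φ R L m2 j x = 0 :=
    fun m2 hm j x hx => hφ.cov_eq_zero hm.1 (by linarith [hm.2]) hL1 hx
  have hβ := continuousOn_beta hL1 hc h0
  have hθ := continuousOn_theta hL1 hc h0
  have hη := continuousOn_etaPrime hc
  have hξ := continuousOn_xiPrime hL1 hc h0
  have hπ := continuousOn_piPrime hL1 hc h0
  refine ⟨fun j => ⟨hβ j, hθ j, hη j, hξ j, hπ j, continuousOn_sigma hL1 hc h0 j,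
    continuousOn_zeta hL1 hc h0 j, continuousOn_w1 hL1 hc h0 j, continuousOn_wStar hL1 hc h0 j,
    continuousOn_wSqStar hL1 hc h0 j, fun a b => hc (j + 1) (b - a),
    fun a b jab V => continuousOn_phiPt hL1 hc h0 a b jab j V⟩, fun j => ?_, fun Ω hΩ => ?_⟩
  · have hη' : ContinuousOn (fun m2 => (barFlow L (cov φ R L m2)).eta j) (Set.Icc 0 mbar2) :=
      continuousOn_const.mul (hη j)
    have hξ' : ContinuousOn (fun m2 => (barFlow L (cov φ R L m2)).xi j) (Set.Icc 0 mbar2) :=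
      continuousOn_const.mul (hξ j)
    have hω' : ContinuousOn (fun m2 => (barFlow L (cov φ R L m2)).omega j) (Set.Icc 0 mbar2) :=
      continuousOn_const.mul (hβ j)
    have hπ' : ContinuousOn (fun m2 => (barFlow L (cov φ R L m2)).pi j) (Set.Icc 0 mbar2) :=
      continuousOn_const.mul (hπ j)
    refine ⟨hβ j, hθ j, hη', hξ', hω', hπ', fun V => ?_⟩
    refine (continuousOn_const.sub ((hβ j).mul continuousOn_const)).prodMk
      ((continuousOn_const.sub ((hθ j).mul continuousOn_const)).prodMk ?_)
    change ContinuousOn (fun m2 => (L : ℝ) ^ 2 * V.2.2 + (barFlow L (cov φ R L m2)).eta j * V.1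
      - (barFlow L (cov φ R L m2)).xi j * V.1 ^ 2 - (barFlow L (cov φ R L m2)).omega j * V.1 * V.2.2
      - (barFlow L (cov φ R L m2)).pi j * V.1 * V.2.1) _
    fun_prop
  have hL2 : (2 : ℝ) ≤ L := by exact_mod_cast hL
  have hb : 1 < (L : ℝ) ^ 2 := by nlinarith
  have hb0 : 0 < (L : ℝ) ^ 2 := by linarith
  -- an exponent `s` for which the decay factor beats `Ω`
  obtain ⟨s, hs⟩ := pow_unbounded_of_one_lt Ω hb
  obtain ⟨K, hK, hbound⟩ := exists_barFlow_le hφ hmbar2.le hR hL s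
  obtain ⟨c, ε, j₀, hcpos, hε, hlow⟩ := exists_le_beta hφ hmbar2.le hR hL
  set K₁ : ℝ := max 1 ((4 * R) ^ s) with hK₁
  have hK₁1 : 1 ≤ K₁ := le_max_left _ _
  obtain ⟨p, hp⟩ := pow_unbounded_of_one_lt (K * K₁ / c) hΩ
  rw [div_lt_iff₀ hcpos] at hp
  obtain ⟨q, hq⟩ := pow_unbounded_of_one_lt ε⁻¹ hb
  have hbdχ : ∀ m2 ∈ Set.Icc 0 mbar2, ∀ j, massDecay R L s m2 j ≤ 1 := fun m2 hm j =>
    massDecay_le_one hR0 hm.1 L s j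
  have hβbd : ∀ m2 ∈ Set.Icc 0 mbar2, ∀ j, |(barFlow L (cov φ R L m2)).beta j| ≤ K * K₁ := by
    intro m2 hm j
    refine (hbound m2 hm j).1.trans (mul_le_mul_of_nonneg_left ((hbdχ m2 hm j).trans hK₁1) hK)
  set δ : ℝ := min mbar2 (((L : ℝ) ^ 2) ^ (j₀ + q))⁻¹ with hδ
  have hδ0 : 0 < δ := by positivity
  have hδm : δ ≤ mbar2 := min_le_left _ _
  have hlow0 : ∀ j, j₀ ≤ j → c ≤ (barFlow L (cov φ R L 0)).beta j := fun j hj =>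
    hlow 0 ⟨le_rfl, hmbar2.le⟩ j hj (by rw [zero_mul]; exact hε.le)
  have htop : jOmega Ω (barFlow L (cov φ R L 0)).beta = ⊤ :=
    jOmega_eq_top hΩ hcpos (hβbd 0 ⟨le_rfl, hmbar2.le⟩) hlow0
  -- the estimates at positive mass
  have hmass : ∀ m2 ∈ Set.Ioc 0 δ, ∃ (n : ℕ) (l : ℤ),
      massScale L m2 = (l : WithTop ℤ) ∧ m2⁻¹ < ((L : ℝ) ^ 2) ^ (l + 1) ∧
      jOmega Ω (barFlow L (cov φ R L m2)).beta = n ∧ l - q - p ≤ n ∧ (n : ℤ) ≤ l + 1 + p ∧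
      AssumptionA1 Ω (K * K₁) (min c ((j₀ + (1 + p + q) : ℕ) + 1 : ℝ)⁻¹)
        (barFlow L (cov φ R L m2)) := by
    intro m2 hm
    have hm' : m2 ∈ Set.Icc 0 mbar2 := ⟨hm.1.le, hm.2.trans hδm⟩
    obtain ⟨l, hl, hl1, hl2⟩ := exists_massScale_eq hL hm.1
    have hjl : (j₀ : ℤ) + q ≤ l := by
      have h1 : ((L : ℝ) ^ 2) ^ ((j₀ + q : ℕ) : ℤ) ≤ m2⁻¹ := by
        rw [zpow_natCast, le_inv_comm₀ (by positivity) hm.1]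
        exact hm.2.trans (min_le_right _ _)
      have h2 := (zpow_lt_zpow_iff_right₀ hb).1 (h1.trans_lt hl2)
      push_cast at h2
      lia
    have hgeom : ∀ j : ℕ, |(barFlow L (cov φ R L m2)).beta j| ≤ K * K₁ * Ω ^ (l + 1 - j) := by
      intro j
      rw [mul_assoc]
      exact (hbound m2 hm' j).1.trans
        (mul_le_mul_of_nonneg_left (massDecay_le_zpow hΩ hR0 hL hs.le hm.1 hl2 j) hK)
    have hlow' : ∀ j : ℕ, j₀ ≤ j → (j : ℤ) ≤ l - q → c ≤ (barFlow L (cov φ R L m2)).beta j := by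
      intro j hj hjq
      refine hlow m2 hm' j hj ?_
      rw [le_inv_comm₀ (by positivity) hm.1] at hl1
      calc m2 * (L : ℝ) ^ (2 * j) ≤ (((L : ℝ) ^ 2) ^ l)⁻¹ * ((L : ℝ) ^ 2) ^ (j : ℤ) := by
            rw [pow_mul, zpow_natCast]
            gcongr
        _ = ((L : ℝ) ^ 2) ^ (-l + j) := by rw [zpow_add₀ hb0.ne', zpow_neg]
        _ ≤ ((L : ℝ) ^ 2) ^ (-(q : ℤ)) := zpow_le_zpow_right₀ hb.le (by lia)
        _ = (((L : ℝ) ^ 2) ^ q)⁻¹ := by rw [zpow_neg, zpow_natCast]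
        _ ≤ ε := by
            rw [inv_le_comm₀ (by positivity) hε]
            exact hq.le
    obtain ⟨n, hn⟩ := scale_estimates hΩ hcpos (hp.le.trans_eq (mul_comm _ _)) hjl (hβbd m2 hm') hgeom hlow'
    exact ⟨n, l, hl, hl2, hn⟩
  refine ⟨δ, hδ0, hδm, ⟨K * K₁, min c ((j₀ + (1 + p + q) : ℕ) + 1 : ℝ)⁻¹,
    K * (K₁ * Ω ^ (1 + q + p)), by positivity, fun m2 hm => ?_⟩,
    ⟨1 + q + p, fun m2 hm => ?_⟩, massScale_zero L, htop⟩
  · have hm' : m2 ∈ Set.Icc 0 mbar2 := ⟨hm.1, hm.2.trans hδm⟩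
    -- both cases bound the decay factor by the decay of (A2)
    suffices h : AssumptionA1 Ω (K * K₁) (min c ((j₀ + (1 + p + q) : ℕ) + 1 : ℝ)⁻¹)
        (barFlow L (cov φ R L m2)) ∧ ∀ j, massDecay R L s m2 j
          ≤ K₁ * Ω ^ (1 + q + p) * decay Ω (jOmega Ω (barFlow L (cov φ R L m2)).beta) j by
      refine ⟨h.1, fun j => ?_⟩
      have hj := mul_le_mul_of_nonneg_left (h.2 j) hK
      rw [← mul_assoc] at hj
      obtain ⟨-, h1, h2, h3, h4, h5⟩ := hbound m2 hm' j
      exact ⟨h1.trans hj, h2.trans hj, h3.trans hj, h4.trans hj, h5.trans hj⟩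
    rcases hm.1.eq_or_lt with rfl | hpos
    · refine ⟨assumptionA1_of_subset (hβbd 0 hm') (Finset.range j₀)
        (by rw [Finset.card_range]; lia) (min_le_right _ _) (by positivity) fun j _ hj => ?_,
        fun j => ?_⟩
      · by_contra hcon
        have h1 := hlow0 j (by simpa using hcon)
        have h2 := min_le_left c ((j₀ + (1 + p + q) : ℕ) + 1 : ℝ)⁻¹
        linarith
      · rw [htop, decay_top, mul_one]
        exact (hbdχ 0 hm' j).trans (one_le_mul_of_one_le_of_one_le hK₁1 (one_le_pow₀ hΩ.le))
    · obtain ⟨n, l, -, hl2, hn, hln, -, hA1⟩ := hmass m2 ⟨hpos, hm.2⟩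
      refine ⟨hA1, fun j => ?_⟩
      rw [hn]
      exact le_mul_decay hΩ hK₁1 (hbdχ m2 hm' j) (massDecay_le_zpow hΩ hR0 hL hs.le hpos hl2 j)
        (by push_cast; lia)
  · obtain ⟨n, l, hl, -, hn, hln, hnl, -⟩ := hmass m2 hm
    refine ⟨n, l, hn, hl, ?_⟩
    have h1 : (l : ℝ) - q - p ≤ n := by exact_mod_cast hln
    have h2 : (n : ℝ) ≤ l + 1 + p := by exact_mod_cast hnl
    have hq0 : (0 : ℝ) ≤ q := Nat.cast_nonneg q
    rw [abs_le]
    constructor <;> linarith
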